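/- **Setting.** A source at the origin of $\mathbb{R}^2$ has $n_T\ge 2$ antennas. Single-antenna eavesdroppers are located at the points $(x_i)_i$ of a homogeneous Poisson point process of density $\lambda_E>0$; put $r_i=\|x_i\|$. Let $\eta>2$ be the path loss exponent, $0<\zeta<1$ the power allocation ratio, $P_s>0$ the transmit power and $\sigma_n>0$ the noise power. Let $\hat{\boldsymbol h}\in\mathbb{C}^{n_T}$ be the (random, almost surely nonzero) estimated legitimate channel, $\boldsymbol w^{\mathsf T}=\hat{\boldsymbol h}^\dagger/\|\hat{\boldsymbol h}\|$, and $\mathbf G\in\mathbb{C}^{n_T\times(n_T-1)}$ a random matrix whose columns together with $\boldsymbol w$ almost surely form an orthonormal basis of $\mathbb{C}^{n_T}$. The fading vectors $\boldsymbol h_i\in\mathbb{C}^{n_T}$ of the eavesdroppers are i.i.d. with i.i.d. $\mathcal{CN}(0,1)$ entries, and the family $(\boldsymbol h_i)_i$ is independent of $((x_i)_i,\hat{\boldsymbol h},\mathbf G)$. The SINR of the $i$-th eavesdropper and the equivalent wiretap SINR under collusion are $$\gamma_i=\frac{\zeta P_s r_i^{-\eta}|\boldsymbol w^{\mathsf T}\boldsymbol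 h_i|^2}{(1-\zeta)P_s\|\boldsymbol h_i^{\mathsf T}\mathbf G\|^2 r_i^{-\eta}/(n_T-1)+\sigma_n},\qquad \gamma=\sum_i\gamma_i .$$ Write $\overline F_\gamma(\omega)=\Pr(\gamma>\omega)$ and $\mathcal L_\gamma(s)=\mathbb E[e^{-s\gamma}]$. Let $$a_1=\zeta\tfrac{P_s}{\sigma_n},\quad \varrho=\frac{(1-\zeta)P_s/\sigma_n}{n_T-1},\quad \varsigma=\frac{\zeta(n_T-1)}{1-\zeta},\quad \mathcal B=\frac{B\left(\frac2\eta,1-\frac2\eta\right)}{\eta}\,\varrho^{\frac{1-n_T+2/\eta}{2}},$$ where $B$ is the Beta function, and let $W_{\kappa,\mu}$ be the Whittaker function, which for $z>0$ and $2\mu\notin\mathbb Z$ is $$W_{\kappa,\mu}(z)=\tfrac{\Gamma(-2\mu)}{\Gamma(\frac12-\mu-\kappa)}M_{\kappa,\mu}(z)+\tfrac{\Gamma(2\mu)}{\Gamma(\frac12+\mu-\kappa)}M_{\kappa,-\mu}(z),\qquad M_{\kappa,\mu}(z)=z^{\mu+\frac12}e^{-z/2}{}_1F_1\left(\mu-\kappa+\tfrac12;2\mu+1;z\right).$$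 **Lemma 2.** The sum defining $\gamma$ converges almost surely, and the following hold. (1) For every $s>0$, $$\mathcal L_\gamma(s)=\exp\left(-2\pi\lambda_E\,\mathcal B\,e^{\varsigma s/2}\,(a_1s)^{\frac{n_T-1+2/\eta}{2}}\;W_{\frac{1-n_T+2/\eta}{2},\,\frac{2-n_T-2/\eta}{2}}(\varsigma s)\right).$$ (2) The CCDF of $\gamma$ is approximated, with an approximate lower bound, by an alternating binomial sum of values of $\mathcal L_\gamma$, $$\overline F_\gamma(\omega)\;\gtrapprox\;\sum_{k=0}^{K}\binom Kk(-1)^k\,\mathcal L_\gamma\left(\frac{k\varphi}{\omega}\right),\qquad \varphi=\frac{K}{\sqrt[K]{K!}},$$ in the following precise sense. For $K\ge1$ let $\mathfrak I_K$ be a normalized Gamma variable (shape $K$, mean $1$) independent of $\gamma$. For every $\omega>0$, $$\overline F_\gamma(\omega)=\lim_{K\to\infty}\Pr\left(\frac{\gamma}{\omega}>\mathfrak I_K\right),$$ and for every $K\ge1$ and $\omega>0$, $$\Pr\left(\frac{\gamma}{\omega}>\mathfrak I_K\right)\;\ge\;\mathbb E\left[\left(1-e^{-\varphi\gamma/\omega}\right)^K\right]=\sum_{k=0}^{K}\binom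 Kk(-1)^k\,\mathcal L_\gamma\left(\frac{k\varphi}{\omega}\right).$$ -/

import Mathlib

open MeasureTheory ProbabilityTheory Filter Topology Matrix
open scoped NNReal ENNReal

noncomputable section

namespace Wiretap

/-! ### Special functions -/

/-- The confluent hypergeometric (Kummer) function
`Φ(a, c; z) = ∑ₖ (a)ₖ / (c)ₖ * zᵏ / k!`, where `(x)ₖ` is the rising factorial
(for `c` not a nonpositive integer). -/
def kummer (a c z : ℝ) : ℝ :=
  ∑' k : ℕ, (ascPochhammer ℝ k).eval a / (ascPochhammer ℝ k).eval c * (z ^ k / (k.factorial : ℝ))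

/-- The Whittaker function `M_{κ,μ}(z) = z^{μ+1/2} e^{-z/2} Φ(μ - κ + 1/2, 2μ + 1; z)`. -/
def whittakerM (κ μ z : ℝ) : ℝ :=
  z ^ (μ + 1 / 2) * Real.exp (-z / 2) * kummer (μ - κ + 1 / 2) (2 * μ + 1) z

/-- The Whittaker function
`W_{κ,μ}(z) = Γ(-2μ)/Γ(1/2-μ-κ) M_{κ,μ}(z) + Γ(2μ)/Γ(1/2+μ-κ) M_{κ,-μ}(z)`,
for `z > 0` and `2μ` not an integer. -/
def whittakerW (κ μ z : ℝ) : ℝ :=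
  Real.Gamma (-2 * μ) / Real.Gamma (1 / 2 - μ - κ) * whittakerM κ μ z
    + Real.Gamma (2 * μ) / Real.Gamma (1 / 2 + μ - κ) * whittakerM κ (-μ) z

/-! ### Poisson point processes and Rayleigh fading -/

/-- The plane in which the eavesdroppers are placed; the source is at the origin. -/
abbrev Plane : Type := EuclideanSpace ℝ (Fin 2)

/-- The number of points of the random family `X` that lie in `A`. -/
def pointCount {Ω E : Type*} (X : ℕ → Ω → E) (A : Set E) (ω : Ω) : ℕ∞ :=
  {i : ℕ | X i ω ∈ A}.encard

/-- `X` enumerates the points of a Poisson point process with intensity measure `Λ` (of infinite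
total mass, so that there are infinitely many points): the number of points in a measurable set
of finite intensity is Poisson with parameter `Λ A`, and the numbers of points in finitely many
pairwise disjoint measurable sets are independent. -/
structure IsPoissonPointProcess {Ω E : Type*} [MeasurableSpace Ω] [MeasurableSpace E]
    (X : ℕ → Ω → E) (Λ : Measure E) (P : Measure Ω) : Prop where
  measurable : ∀ i, Measurable (X i)
  hasLaw_count : ∀ A : Set E, MeasurableSet A → Λ A ≠ ∞ →
    HasLaw (pointCount X A) ((poissonMeasure (Λ A).toNNReal).map (Nat.cast : ℕ → ℕ∞)) P
  indep_count : ∀ (k : ℕ) (A : Fin k → Set E), (∀ j, MeasurableSet (A j)) →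
    Pairwise (fun j l => Disjoint (A j) (A l)) → iIndepFun (fun j => pointCount X (A j)) P

/-- The circularly symmetric complex Gaussian law `CN(0,1)`: the real and imaginary parts are
independent centred Gaussians of variance `1/2`. -/
def stdComplexGaussian : Measure ℂ :=
  ((gaussianReal 0 (1 / 2)).prod (gaussianReal 0 (1 / 2))).map
    (fun p : ℝ × ℝ => (⟨p.1, p.2⟩ : ℂ))

/-! ### The transmission scheme -/

/-- The Euclidean norm of a complex vector. -/
def l2norm {m : ℕ} (v : Fin m → ℂ) : ℝ :=
  ‖(WithLp.toLp 2 v : EuclideanSpace ℂ (Fin m))‖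

/-- The maximum ratio transmission beamformer `w`, with `wᵀ = g† / ‖g‖`, for the estimated
legitimate channel vector `g`. -/
def mrtBeamformer {n : ℕ} (g : Fin n → ℂ) : Fin n → ℂ :=
  fun j => star (g j) / (l2norm g : ℂ)

/-- `w` and the columns of the `n × (n-1)` matrix `G` are an orthonormal basis of `ℂⁿ`. -/
def IsOrthonormalCompletion {n : ℕ} (w : Fin n → ℂ) (G : Matrix (Fin n) (Fin (n - 1)) ℂ) : Prop :=
  star w ⬝ᵥ w = 1 ∧ Gᴴ * G = 1 ∧ Gᴴ *ᵥ w = 0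

/-- The SINR, for confidential packets, of an eavesdropper at position `x` with small-scale
fading vector `h`, where `ζ` is the power allocation ratio, `Ps` the transmit power, `σ` the noise
power, `η` the path loss exponent, `w` the beamformer and `G` the artificial-noise matrix:
`ζ Ps r^{-η} |wᵀh|² / ((1-ζ) Ps ‖hᵀG‖² r^{-η} / (n-1) + σ)` with `r = ‖x‖`. -/
def eveSINR {n : ℕ} (ζ Ps σ η : ℝ) (w : Fin n → ℂ) (G : Matrix (Fin n) (Fin (n - 1)) ℂ)
    (x : Plane) (h : Fin n → ℂ) : ℝ :=
  ζ * Ps * ‖x‖ ^ (-η) * ‖w ⬝ᵥ h‖ ^ 2 /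
    ((1 - ζ) * Ps * l2norm (h ᵥ* G) ^ 2 * ‖x‖ ^ (-η) / ((n : ℝ) - 1) + σ)

/-- The SINR of the `i`-th eavesdropper as a random variable: `X i` is its position, `h i` its
fading vector, `g` the estimated legitimate channel, `G` the artificial-noise matrix. -/
def sinr {Ω : Type*} {n : ℕ} (ζ Ps σ η : ℝ) (g : Ω → Fin n → ℂ)
    (G : Ω → Matrix (Fin n) (Fin (n - 1)) ℂ) (X : ℕ → Ω → Plane) (h : ℕ → Ω → Fin n → ℂ)
    (i : ℕ) (ω : Ω) : ℝ :=
  eveSINR ζ Ps σ η (mrtBeamformer (g ω)) (G ω) (X i ω) (h i ω)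

/-- The equivalent wiretap SINR under collusion: the sum of the SINRs of all eavesdroppers. -/
def colludingSINR {Ω : Type*} {n : ℕ} (ζ Ps σ η : ℝ) (g : Ω → Fin n → ℂ)
    (G : Ω → Matrix (Fin n) (Fin (n - 1)) ℂ) (X : ℕ → Ω → Plane) (h : ℕ → Ω → Fin n → ℂ)
    (ω : Ω) : ℝ :=
  ∑' i, sinr ζ Ps σ η g G X h i ω

/-- The Laplace transform `E[e^{-sY}]` of a nonnegative random variable. -/
def laplace {Ω : Type*} [MeasurableSpace Ω] (P : Measure Ω) (Y : Ω → ℝ) (s : ℝ) : ℝ :=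
  ∫ ω, Real.exp (-s * Y ω) ∂P

/-- The complementary cumulative distribution function. -/
def ccdf {Ω : Type*} [MeasurableSpace Ω] (P : Measure Ω) (Y : Ω → ℝ) (t : ℝ) : ℝ :=
  P.real {ω | t < Y ω}

/-- The law of the normalized Gamma variable with parameter `K` (shape `K`, mean `1`). -/
def normalizedGamma (K : ℕ) : Measure ℝ := gammaMeasure (K : ℝ) (K : ℝ)

/-- `Pr(Y / t > J)` where `J` is a normalized Gamma variable with parameter `K`, independent
of `Y`. -/
def gammaSmoothedCcdf {Ω : Type*} [MeasurableSpace Ω] (P : Measure Ω) (Y : Ω → ℝ) (K : ℕ)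
    (t : ℝ) : ℝ :=
  (P.prod (normalizedGamma K)).real {p | p.2 < Y p.1 / t}

/-- The constant `K / (K!)^{1/K}`. -/
def alzer (K : ℕ) : ℝ := (K : ℝ) / (K.factorial : ℝ) ^ (1 / (K : ℝ))

/-- The alternating binomial sum of Laplace transform values that approximates the
complementary cumulative distribution function of `Y` at `t`. -/
def laplaceCcdfApprox {Ω : Type*} [MeasurableSpace Ω] (P : Measure Ω) (Y : Ω → ℝ) (K : ℕ)
    (t : ℝ) : ℝ :=
  ∑ k ∈ Finset.range (K + 1), (K.choose k : ℝ) * (-1) ^ k * laplace P Y (k * alzer K / t)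

end Wiretap

end

open Wiretap

open Wiretap

/-! The eavesdroppers form a Poisson process carrying independent marks (the fading vectors). Given
the environment (positions, estimated channel, artificial-noise matrix), `w` and the columns of `G`
give a unitary change of coordinates. A standard complex Gaussian vector is invariant under it, so
`‖wᵀh‖²` and `‖hᵀG‖²` are independent, Exp(1) and Gamma(n-1)
(`lintegral_projections_pi_stdComplexGaussian`). The mean of `e^{-sγᵢ}` therefore depends only on
the position: it is `markLaplace`. The Laplace functional of a marked Poisson process
(`lintegral_expNeg_tsum_marks`) turns the transform of the sum into `exp(-λ ∫ (1 - markLaplace))`.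

That integral is evaluated by Tonelli. The exponential mark leaves a rational function of `‖x‖^η`,
the plane integral of which is a Beta constant times `(ϱb + a₁s)^{2/η-1}`. Averaging over the Gamma
variable `b` gives `∫ t^k (1+t)^{δ-1} e^{-zt} dt` with `k = n-2`, `δ = 2/η`, `z = a₁s/ϱ`. This is
Tricomi's integral, identified with the two-term Whittaker combination by induction on `k` through
contiguous relations (`whittakerW_eq_integral`).

Almost sure convergence comes from the same formula, read in `[0,∞]` with `e^{-∞} = 0`: as `s → 0`
the transform tends to the probability that the sum is finite, and the exponent is `O(s^{2/η})`.

For the tail, normalized Gamma laws concentrate at 1 by Chebyshev, so the smoothed tail converges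
wherever `γ` has no atom. There is no positive atom because, conditionally on everything else, the
first summand is atomless (`ae_tsum_marks_ne`). The lower bound is Alzer's inequality for the Gamma
distribution function, integrated against the law of `γ`; the alternating sum is the binomial
theorem. -/

/-! ### Kummer's series and an integral representation of the Whittaker function. -/

lemma hasSum_of_forall_eq {f g : ℕ → ℝ} {a : ℝ} (h : ∀ k, f k = g k) (hg : HasSum g a) :
    HasSum f a := by
  rwa [funext h]

lemma ascPochhammer_eval_succ_left (a : ℝ) (k : ℕ) :
    (ascPochhammer ℝ (k + 1)).eval a = a * (ascPochhammer ℝ k).eval (a + 1) := by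
  rw [ascPochhammer_succ_left]
  simp [Polynomial.eval_comp]

lemma ascPochhammer_eval_ne_zero {c : ℝ} (hc : ∀ k : ℕ, c + k ≠ 0) (k : ℕ) :
    (ascPochhammer ℝ k).eval c ≠ 0 := by
  induction k with
  | zero => simp
  | succ k ih =>
    rw [ascPochhammer_succ_eval]
    exact mul_ne_zero ih (hc k)

lemma Gamma_add_nat_eq (c : ℝ) (hc : 0 < c) (k : ℕ) :
    Real.Gamma (c + k) = (ascPochhammer ℝ k).eval c * Real.Gamma c := by
  induction k with
  | zero => simp
  | succ k ih =>
    rw [ascPochhammer_succ_eval, Nat.cast_succ, ← add_assoc, Real.Gamma_add_one (by positivity), ih]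
    ring

/-- The terms of the confluent hypergeometric series. -/
noncomputable def kummerTerm (a c z : ℝ) (k : ℕ) : ℝ :=
  (ascPochhammer ℝ k).eval a / (ascPochhammer ℝ k).eval c * (z ^ k / (k.factorial : ℝ))

lemma kummerTerm_succ (a c z : ℝ) (k : ℕ) :
    kummerTerm a c z (k + 1) = kummerTerm a c z k * ((a + k) / (c + k) * (z / (k + 1))) := by
  simp only [kummerTerm, ascPochhammer_succ_eval, Nat.factorial_succ, pow_succ]
  push_cast
  simp only [div_eq_mul_inv, mul_inv]
  ring

/-- Ratio test. No condition on `c` is needed: if a denominator vanishes, division by zero makes all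
later terms 0, which the recursion `kummerTerm_succ` respects. -/
lemma summable_kummerTerm (a c z : ℝ) : Summable (kummerTerm a c z) := by
  have hlim : Tendsto (fun k : ℕ => (a + k) / (c + k) * (z / ((k : ℝ) + 1))) atTop (𝓝 (1 * 0)) := by
    refine Tendsto.mul ?_ ?_
    · have h1 : Tendsto (fun k : ℕ => (a - c) / (c + k) + 1) atTop (𝓝 (0 + 1)) :=
        ((tendsto_const_nhds (x := a - c)).div_atTop
          (tendsto_atTop_add_const_left _ c tendsto_natCast_atTop_atTop)).add_const 1
      rw [zero_add] at h1
      refine h1.congr' ?_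
      have : ∀ᶠ k : ℕ in atTop, 0 < c + k :=
        (tendsto_atTop_add_const_left _ c tendsto_natCast_atTop_atTop).eventually_gt_atTop 0
      filter_upwards [this] with k hk
      field_simp
      ring
    · exact (tendsto_const_nhds (x := z)).div_atTop
        (tendsto_atTop_add_const_right _ 1 tendsto_natCast_atTop_atTop)
  rw [mul_zero] at hlim
  have h2 : ∀ᶠ k : ℕ in atTop, ‖(a + k) / (c + k) * (z / ((k : ℝ) + 1))‖ ≤ 1 / 2 :=
    (tendsto_zero_iff_norm_tendsto_zero.mp hlim).eventually_le_const (by norm_num)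
  refine summable_of_ratio_norm_eventually_le (r := 1 / 2) (by norm_num) ?_
  filter_upwards [h2] with k hk
  rw [kummerTerm_succ, norm_mul, mul_comm]
  exact mul_le_mul_of_nonneg_right hk (norm_nonneg _)

lemma hasSum_kummer (a c z : ℝ) : HasSum (kummerTerm a c z) (kummer a c z) :=
  (summable_kummerTerm a c z).hasSum

/-- Holds term by term: both sides are multiples of `(a)ₖ/(b)ₖ`, and the factors agree because `a +
k = (b - 1 + k) - (b - 1 - a)`. -/
lemma kummer_contiguous_left (a b z : ℝ) (hb : ∀ k : ℕ, b - 1 + k ≠ 0) :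
    a * kummer (a + 1) b z = (b - 1) * kummer a (b - 1) z - (b - 1 - a) * kummer a b z := by
  refine (((hasSum_kummer (a + 1) b z).mul_left a).unique ?_)
  refine hasSum_of_forall_eq (fun k => ?_) (((hasSum_kummer a (b - 1) z).mul_left (b - 1)).sub
    ((hasSum_kummer a b z).mul_left (b - 1 - a)))
  simp only [kummerTerm]
  have h1 : a * (ascPochhammer ℝ k).eval (a + 1) = (ascPochhammer ℝ k).eval a * (a + k) := by
    rw [← ascPochhammer_eval_succ_left, ascPochhammer_succ_eval]
  have h2 : (b - 1) * (ascPochhammer ℝ k).eval b = (ascPochhammer ℝ k).eval (b - 1) * (b - 1 + k) := by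
    rw [← ascPochhammer_succ_eval, ascPochhammer_eval_succ_left, sub_add_cancel]
  have hbk : ∀ j : ℕ, b + j ≠ 0 := fun j => by
    have := hb (j + 1); push_cast at this; intro h; apply this; linarith
  have e1 := ascPochhammer_eval_ne_zero hbk k
  have e2 := ascPochhammer_eval_ne_zero hb k
  have e3 : (b - 1) / (ascPochhammer ℝ k).eval (b - 1) = (b - 1 + k) / (ascPochhammer ℝ k).eval b := by
    rw [div_eq_div_iff e2 e1, h2]; ring
  calc a * ((ascPochhammer ℝ k).eval (a + 1) / (ascPochhammer ℝ k).eval b * (z ^ k / k.factorial))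
      = (a * (ascPochhammer ℝ k).eval (a + 1)) / (ascPochhammer ℝ k).eval b *
        (z ^ k / k.factorial) := by ring
    _ = (b - 1 + k) / (ascPochhammer ℝ k).eval b * (ascPochhammer ℝ k).eval a
          * (z ^ k / k.factorial) - (b - 1 - a) * ((ascPochhammer ℝ k).eval a /
          (ascPochhammer ℝ k).eval b * (z ^ k / k.factorial)) := by rw [h1]; ring
    _ = _ := by rw [← e3]; ring

/-- The constant terms cancel. In the next ones, `(a+1)ₖ₊₁ - (a)ₖ₊₁ = (k+1) (a+1)ₖ`, and the factor
`k+1` is absorbed by the factorial, leaving the shifted series. -/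
lemma kummer_contiguous_right (a b z : ℝ) (hb : ∀ k : ℕ, b + k ≠ 0) :
    kummer (a + 1) b z = kummer a b z + z / b * kummer (a + 1) (b + 1) z := by
  have h0 : HasSum (fun k => kummerTerm (a + 1) b z k - kummerTerm a b z k)
      (kummer (a + 1) b z - kummer a b z) := (hasSum_kummer (a + 1) b z).sub (hasSum_kummer a b z)
  have h1 := (hasSum_nat_add_iff' 1).mpr h0
  have h2 := (hasSum_kummer (a + 1) (b + 1) z).mul_left (z / b)
  have h3 : (fun k => kummerTerm (a + 1) b z (k + 1) - kummerTerm a b z (k + 1)) =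
      fun k => z / b * kummerTerm (a + 1) (b + 1) z k := by
    ext k
    simp only [kummerTerm]
    rw [ascPochhammer_eval_succ_left a, ascPochhammer_eval_succ_left b, ascPochhammer_succ_eval,
      Nat.factorial_succ]
    have hb1 : ∀ j : ℕ, b + 1 + j ≠ 0 := fun j => by
      have := hb (j + 1); push_cast at this; intro h; apply this; linarith
    have e1 := ascPochhammer_eval_ne_zero hb1 k
    have e2 : b ≠ 0 := by simpa using hb 0
    have e3 : (k.factorial : ℝ) ≠ 0 := by positivity
    push_cast
    field_simp
    ring
  rw [h3] at h1
  have h4 := h1.unique h2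
  simp only [Finset.range_one, Finset.sum_singleton, kummerTerm, ascPochhammer_zero,
    Polynomial.eval_one] at h4
  linarith

lemma kummer_self (a z : ℝ) (ha : ∀ k : ℕ, a + k ≠ 0) : kummer a a z = Real.exp z := by
  refine (hasSum_kummer a a z).unique ?_
  rw [Real.exp_eq_exp_ℝ]
  refine hasSum_of_forall_eq (fun k => ?_) (NormedSpace.expSeries_div_hasSum_exp z)
  rw [kummerTerm, div_self (ascPochhammer_eval_ne_zero ha k), one_mul]

lemma integral_rpow_mul_one_sub_pow {c : ℝ} (hc : 0 < c) (k : ℕ) :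
    ∫ u in (0 : ℝ)..1, u ^ (c - 1) * (1 - u) ^ k = beta c (k + 1) := by
  rw [beta_eq_betaIntegralReal c _ hc (by positivity), Complex.betaIntegral]
  have : ∀ u ∈ Set.uIcc (0 : ℝ) 1, (u : ℂ) ^ ((c : ℂ) - 1) * (1 - (u : ℂ)) ^ ((((k : ℝ) + 1 : ℝ) : ℂ) - 1)
      = ((u ^ (c - 1) * (1 - u) ^ k : ℝ) : ℂ) := by
    intro u hu
    rw [Set.uIcc_of_le zero_le_one] at hu
    push_cast
    rw [add_sub_cancel_right, Complex.cpow_natCast, Complex.ofReal_cpow hu.1]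
    simp
  rw [intervalIntegral.integral_congr this, intervalIntegral.integral_ofReal, Complex.ofReal_re]

lemma intervalIntegrable_rpow_sub_one {c : ℝ} (hc : 0 < c) (a b : ℝ) :
    IntervalIntegrable (fun u : ℝ => u ^ (c - 1)) volume a b :=
  intervalIntegral.intervalIntegrable_rpow' (by linarith)

/-- Expanding the exponential gives a Beta integral in each degree; termwise integration is
dominated by the series of `e^z` times the integrable `u^{c-1}`. -/
lemma integral_rpow_mul_exp_one_sub {c z : ℝ} (hc : 0 < c) (hz : 0 < z) :
    ∫ u in (0 : ℝ)..1, u ^ (c - 1) * Real.exp (z * (1 - u)) = c⁻¹ * kummer 1 (1 + c) z := by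
  have key : HasSum (fun k : ℕ => ∫ u in (0 : ℝ)..1, u ^ (c - 1) * ((z * (1 - u)) ^ k / k.factorial))
      (∫ u in (0 : ℝ)..1, u ^ (c - 1) * Real.exp (z * (1 - u))) := by
    refine intervalIntegral.hasSum_integral_of_dominated_convergence
      (fun k u => u ^ (c - 1) * (z ^ k / k.factorial)) (fun k => ?_) (fun k => ?_) ?_ ?_ ?_
    · exact Measurable.aestronglyMeasurable (by fun_prop)
    · refine .of_forall fun u hu => ?_
      rw [Set.uIoc_of_le zero_le_one] at hu
      rw [Real.norm_of_nonneg (mul_nonneg (Real.rpow_nonneg hu.1.le _)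
        (div_nonneg (pow_nonneg (mul_nonneg hz.le (by linarith [hu.2])) _) (by positivity)))]
      have : z * (1 - u) ≤ z := by nlinarith [hu.1]
      have h0 : 0 ≤ z * (1 - u) := mul_nonneg hz.le (by linarith [hu.2])
      have := Real.rpow_nonneg hu.1.le (c - 1)
      gcongr
    · refine .of_forall fun u _ => ?_
      exact (Real.summable_pow_div_factorial z).mul_left _
    · simp_rw [tsum_mul_left]
      exact (intervalIntegrable_rpow_sub_one hc _ _).mul_const _
    · refine .of_forall fun u _ => ?_
      rw [Real.exp_eq_exp_ℝ]
      exact (NormedSpace.expSeries_div_hasSum_exp (z * (1 - u))).mul_left _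
  refine key.unique ?_
  refine hasSum_of_forall_eq (fun k => ?_) ((hasSum_kummer 1 (1 + c) z).mul_left c⁻¹)
  have : ∀ u : ℝ, u ^ (c - 1) * ((z * (1 - u)) ^ k / k.factorial) =
      (z ^ k / k.factorial) * (u ^ (c - 1) * (1 - u) ^ k) := fun u => by rw [mul_pow]; ring
  simp_rw [this]
  rw [intervalIntegral.integral_const_mul, integral_rpow_mul_one_sub_pow hc, beta, kummerTerm]
  have h1 : Real.Gamma (c + (k + 1)) = c * (ascPochhammer ℝ k).eval (1 + c) * Real.Gamma c := by
    have := Gamma_add_nat_eq c hc (k + 1)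
    push_cast at this
    rw [this, ascPochhammer_eval_succ_left, add_comm c 1]
  have h2 : (ascPochhammer ℝ k).eval (1 : ℝ) = Real.Gamma (k + 1) := by
    have := Gamma_add_nat_eq 1 one_pos k
    rw [Real.Gamma_one, mul_one] at this
    rw [← this, add_comm]
  rw [h1, h2]
  have := (Real.Gamma_pos_of_pos hc).ne'
  field_simp

lemma integrableOn_pow_mul_one_add_rpow (k : ℕ) (c : ℝ) {z : ℝ} (hz : 0 < z) :
    IntegrableOn (fun t : ℝ => t ^ k * (1 + t) ^ (c - 1) * Real.exp (-(z * t))) (Set.Ioi 0) := by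
  have hcont : ContinuousOn (fun t : ℝ => t ^ k * (1 + t) ^ (c - 1) * Real.exp (-(z * t)))
      (Set.Ici 0) := by
    refine ContinuousOn.mul (ContinuousOn.mul (by fun_prop) ?_) (by fun_prop)
    refine ContinuousOn.rpow_const (by fun_prop) fun t ht => Or.inl ?_
    have : (0 : ℝ) ≤ t := ht
    positivity
  refine integrable_of_isBigO_exp_neg (half_pos hz) hcont ?_
  have h1 : (fun t : ℝ => t ^ k * (1 + t) ^ (c - 1) * Real.exp (-(z * t))) =O[atTop]
      (fun t : ℝ => (1 + t) ^ ((k : ℝ) + |c - 1|) * Real.exp (-(z * t))) := by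
    refine Asymptotics.IsBigO.of_bound 1 ?_
    filter_upwards [eventually_ge_atTop (0 : ℝ)] with t ht
    rw [one_mul, Real.norm_of_nonneg (by positivity), Real.norm_of_nonneg (by positivity)]
    rw [Real.rpow_add (by positivity), Real.rpow_natCast]
    gcongr
    · linarith
    · linarith
    · exact le_abs_self _
  refine h1.trans ?_
  have h2 := isLittleO_rpow_exp_pos_mul_atTop ((k : ℝ) + |c - 1|) (half_pos hz)
  have h3 := (h2.comp_tendsto (tendsto_atTop_add_const_left atTop (1 : ℝ) tendsto_id)).isBigO
  have h4 := h3.mul (Asymptotics.isBigO_refl (fun t : ℝ => Real.exp (-(z * t))) atTop)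
  refine (h4.trans ?_)
  have : (fun t : ℝ => (((fun x => Real.exp (z / 2 * x)) ∘ fun x : ℝ => 1 + id x) t) *
      Real.exp (-(z * t))) = fun t => Real.exp (z / 2) * Real.exp (-(z / 2) * t) := by
    ext t
    simp only [Function.comp, id]
    rw [← Real.exp_add, ← Real.exp_add]
    congr 1; ring
  rw [this]
  exact (Asymptotics.isBigO_refl _ _).const_mul_left _

/-- After the shift `u = 1 + t` this is the Gamma integral over `(0,∞)` minus its part over `(0,1)`.
It is the base case for the induction on the power of `t`. -/
lemma integral_one_add_rpow_mul_exp {c z : ℝ} (hc : 0 < c) (hz : 0 < z) :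
    ∫ t in Set.Ioi (0 : ℝ), (1 + t) ^ (c - 1) * Real.exp (-(z * t)) =
      Real.Gamma c * z ^ (-c) * Real.exp z - c⁻¹ * kummer 1 (1 + c) z := by
  have hshift : ∫ t in Set.Ioi (0 : ℝ), (1 + t) ^ (c - 1) * Real.exp (-(z * t)) =
      ∫ u in Set.Ioi (1 : ℝ), u ^ (c - 1) * Real.exp (z * (1 - u)) := by
    have := (measurePreserving_add_left (volume : Measure ℝ) 1).setIntegral_preimage_emb
      (measurableEmbedding_addLeft 1) (fun u : ℝ => u ^ (c - 1) * Real.exp (z * (1 - u)))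
      (Set.Ioi 1)
    rw [← this]
    have hpre : (fun t : ℝ => 1 + t) ⁻¹' Set.Ioi 1 = Set.Ioi 0 := by ext t; simp
    rw [hpre]
    refine setIntegral_congr_fun measurableSet_Ioi fun t _ => ?_
    congr 3; ring
  have hG : ∀ u : ℝ, u ^ (c - 1) * Real.exp (z * (1 - u)) =
      Real.exp z * (u ^ (c - 1) * Real.exp (-(z * u))) := fun u => by
    rw [show z * (1 - u) = z + -(z * u) by ring, Real.exp_add]; ring
  have hint : IntegrableOn (fun u : ℝ => u ^ (c - 1) * Real.exp (z * (1 - u))) (Set.Ioi 0) := by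
    simp_rw [hG]
    refine Integrable.const_mul ?_ _
    have := integrableOn_rpow_mul_exp_neg_mul_rpow (s := c - 1) (p := 1) (by linarith) one_pos hz
    simpa [IntegrableOn] using this
  have htot : ∫ u in Set.Ioi (0 : ℝ), u ^ (c - 1) * Real.exp (z * (1 - u)) =
      Real.Gamma c * z ^ (-c) * Real.exp z := by
    simp_rw [hG]
    rw [integral_const_mul, Real.integral_rpow_mul_exp_neg_mul_Ioi hc hz, one_div,
      Real.inv_rpow hz.le, Real.rpow_neg hz.le]
    ring
  have hsplit := intervalIntegral.integral_interval_add_Ioi hint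
    (hint.mono_set (Set.Ioi_subset_Ioi zero_le_one))
  rw [integral_rpow_mul_exp_one_sub hc hz, htot] at hsplit
  rw [hshift]; linarith

/-- This is the connection formula for Tricomi's function `k! U(k+1, k+1+c, z)`. The induction uses
`t^{k+1}(1+t)^{c-1} = t^k(1+t)^c - t^k(1+t)^{c-1}`, so it must run over all `c` at once. The two
contiguous relations recombine the Kummer functions. Non-integrality of `c` keeps Gamma factors and
lower parameters away from poles. -/
lemma integral_pow_mul_one_add_rpow_mul_exp (k : ℕ) {c z : ℝ} (hc : 0 < c) (hz : 0 < z)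
    (hci : ∀ j : ℤ, c ≠ j) :
    ∫ t in Set.Ioi (0 : ℝ), t ^ k * (1 + t) ^ (c - 1) * Real.exp (-(z * t)) =
      k.factorial * (Real.Gamma (-k - c) / Real.Gamma (1 - c)) * kummer (k + 1) (k + 1 + c) z +
      Real.Gamma (k + c) * z ^ (-k - c) * kummer (1 - c) (1 - k - c) z := by
  induction k generalizing c with
  | zero =>
    have hne : ∀ k : ℕ, 1 - c + k ≠ 0 := fun k h => hci (1 + k) (by push_cast; linarith)
    have hg : Real.Gamma (1 - c) = -c * Real.Gamma (-c) := by
      rw [← Real.Gamma_add_one (by linarith)]; congr 1; ring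
    have hg0 : Real.Gamma (-c) ≠ 0 := Real.Gamma_ne_zero fun m h =>
      hci m (by push_cast; linarith)
    simp only [pow_zero, one_mul, Nat.factorial_zero, Nat.cast_one, Nat.cast_zero, zero_add,
      neg_zero, zero_sub, sub_zero]
    rw [integral_one_add_rpow_mul_exp hc hz, kummer_self _ _ hne, hg]
    field_simp
    ring
  | succ k ih =>
    have hci' : ∀ j : ℤ, c + 1 ≠ j := fun j h => hci (j - 1) (by push_cast; linarith)
    have hrec : ∫ t in Set.Ioi (0 : ℝ), t ^ (k + 1) * (1 + t) ^ (c - 1) * Real.exp (-(z * t)) =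
        (∫ t in Set.Ioi (0 : ℝ), t ^ k * (1 + t) ^ (c + 1 - 1) * Real.exp (-(z * t))) -
        ∫ t in Set.Ioi (0 : ℝ), t ^ k * (1 + t) ^ (c - 1) * Real.exp (-(z * t)) := by
      rw [← integral_sub (integrableOn_pow_mul_one_add_rpow k (c + 1) hz)
        (integrableOn_pow_mul_one_add_rpow k c hz)]
      refine setIntegral_congr_fun measurableSet_Ioi fun t ht => ?_
      have ht' : (0 : ℝ) < t := ht
      rw [show c + 1 - 1 = (c - 1) + 1 by ring, Real.rpow_add_one (by positivity)]
      ring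
    rw [hrec, ih (by linarith) hci', ih hc hci]
    have g1 : Real.Gamma (1 - c) = -c * Real.Gamma (-c) := by
      rw [← Real.Gamma_add_one (by linarith)]; congr 1; ring
    have g2 : Real.Gamma (-k - c) = (-(k + 1 : ℝ) - c) * Real.Gamma (-(k + 1 : ℝ) - c) := by
      rw [← Real.Gamma_add_one (fun h => hci (-(k + 1)) (by push_cast; linarith))]
      congr 1; ring
    have g3 : Real.Gamma (k + 1 + c) = (k + c) * Real.Gamma (k + c) := by
      rw [← Real.Gamma_add_one (by positivity)]; congr 1; ring
    have hg0 : Real.Gamma (-c) ≠ 0 := Real.Gamma_ne_zero fun m h =>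
      hci m (by push_cast; linarith)
    have c1 := kummer_contiguous_left (k + 1) (k + 1 + 1 + c) z
      (fun j h => hci (-(k + 1 + j)) (by push_cast; linarith))
    have c2 := kummer_contiguous_right (-c) (-k - c) z
      (fun j h => hci (-k + j) (by push_cast; linarith))
    have z1 : z ^ (-(k : ℝ) - c) = z ^ (-(k + 1 : ℝ) - c) * z := by
      rw [← Real.rpow_add_one hz.ne']; congr 1; ring
    have hkc : (k : ℝ) + c ≠ 0 := by positivity
    push_cast
    rw [Nat.factorial_succ]
    push_cast
    rw [show -(k : ℝ) - (c + 1) = -(k + 1) - c by ring, show 1 - (c + 1) = -c by ring,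
      show (k : ℝ) + 1 + (c + 1) = k + 1 + 1 + c by ring, show (k : ℝ) + (c + 1) = k + 1 + c by ring,
      show 1 - (k : ℝ) - (c + 1) = -k - c by ring, show 1 - ((k : ℝ) + 1) - c = -k - c by ring,
      g1, g2, g3, z1]
    rw [show (k : ℝ) + 1 + 1 + c - 1 = k + 1 + c by ring,
      show (k : ℝ) + 1 + c - (k + 1) = c by ring] at c1
    rw [show -c + 1 = 1 - c by ring, show -(k : ℝ) - c + 1 = 1 - k - c by ring] at c2
    rw [c2]
    have hd : -(k : ℝ) - c ≠ 0 := fun h => hkc (by linarith)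
    have hcne : c ≠ 0 := hc.ne'
    have c1' : kummer (↑k + 1 + 1) (↑k + 1 + 1 + c) z = (((k : ℝ) + 1 + c) * kummer (↑k + 1) (↑k + 1 + c) z -
        c * kummer (↑k + 1) (↑k + 1 + 1 + c) z) / (k + 1) := by
      rw [eq_div_iff (by positivity), ← c1]; ring
    rw [c1']
    have hinv : z / (-(k : ℝ) - c) = -(z / (k + c)) := by
      rw [← neg_add', div_neg]
    rw [hinv]
    field_simp
    ring

/-- With `n = k + 2`, the indices satisfy `1/2 - μ - κ = k + 1` and `-2μ = k + δ`, so the two terms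
of `W` are those of the Tricomi integral, up to the common factor and in the opposite order. -/
lemma whittakerW_eq_integral (k : ℕ) {δ z : ℝ} (hδ0 : 0 < δ) (hδ1 : δ < 1) (hz : 0 < z) :
    whittakerW ((1 - ((k + 2 : ℕ) : ℝ) + δ) / 2) ((2 - ((k + 2 : ℕ) : ℝ) - δ) / 2) z =
      Real.exp (-z / 2) * z ^ (((k : ℝ) + 1 + δ) / 2) * ((k.factorial : ℝ)⁻¹ *
        ∫ t in Set.Ioi (0 : ℝ), t ^ k * (1 + t) ^ (δ - 1) * Real.exp (-(z * t))) := by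
  have hδi : ∀ j : ℤ, δ ≠ j := by
    intro j h
    rw [h] at hδ0 hδ1
    have h0 : (0 : ℤ) < j := by exact_mod_cast hδ0
    have h1 : j < (1 : ℤ) := by exact_mod_cast hδ1
    omega
  rw [integral_pow_mul_one_add_rpow_mul_exp k hδ0 hz hδi, whittakerW, whittakerM, whittakerM]
  push_cast
  have hz2 : z ^ ((1 - (k : ℝ) - δ) / 2) = z ^ (((k : ℝ) + 1 + δ) / 2) * z ^ (-(k : ℝ) - δ) := by
    rw [← Real.rpow_add hz]; congr 1; ring
  rw [show -2 * ((2 - ((k : ℝ) + 2) - δ) / 2) = k + δ by ring,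
    show 1 / 2 - (2 - ((k : ℝ) + 2) - δ) / 2 - (1 - ((k : ℝ) + 2) + δ) / 2 = k + 1 by ring,
    show (2 - ((k : ℝ) + 2) - δ) / 2 + 1 / 2 = (1 - k - δ) / 2 by ring,
    show (2 - ((k : ℝ) + 2) - δ) / 2 - (1 - ((k : ℝ) + 2) + δ) / 2 + 1 / 2 = 1 - δ by ring,
    show 2 * ((2 - ((k : ℝ) + 2) - δ) / 2) + 1 = 1 - k - δ by ring,
    show 2 * ((2 - ((k : ℝ) + 2) - δ) / 2) = -k - δ by ring,
    show 1 / 2 + (2 - ((k : ℝ) + 2) - δ) / 2 - (1 - ((k : ℝ) + 2) + δ) / 2 = 1 - δ by ring,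
    show -((2 - ((k : ℝ) + 2) - δ) / 2) + 1 / 2 = (k + 1 + δ) / 2 by ring,
    show -((2 - ((k : ℝ) + 2) - δ) / 2) - (1 - ((k : ℝ) + 2) + δ) / 2 + 1 / 2 = k + 1 by ring,
    show 2 * -((2 - ((k : ℝ) + 2) - δ) / 2) + 1 = k + 1 + δ by ring, hz2, Real.Gamma_nat_eq_factorial]
  have : (k.factorial : ℝ) ≠ 0 := by positivity
  field_simp
  ring

/-! ### Gamma laws: Alzer's inequality and concentration at the mean. -/

lemma lintegral_gammaMeasure (a r : ℝ) {f : ℝ → ℝ≥0∞} (hf : Measurable f) :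
    ∫⁻ x, f x ∂gammaMeasure a r = ∫⁻ x in Set.Ioi (0 : ℝ),
      ENNReal.ofReal (r ^ a / Real.Gamma a * x ^ (a - 1) * Real.exp (-(r * x))) * f x := by
  rw [gammaMeasure, lintegral_withDensity_eq_lintegral_mul _ (by
    unfold gammaPDF; exact (measurable_gammaPDFReal a r).ennreal_ofReal) hf,
    restrict_Ioi_eq_restrict_Ici, ← lintegral_indicator measurableSet_Ici]
  refine lintegral_congr fun x => ?_
  by_cases hx : 0 ≤ x
  · simp [gammaPDF_of_nonneg hx, Set.indicator, hx]
  · simp [gammaPDF_of_neg (not_le.mp hx), Set.indicator, hx]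

/-- For `v > 0` this is `E[e^{-vU}]` with `U` uniform on `[0,1]`; the value at `v = 0` is the junk
value 0, hence the positivity hypotheses below. -/
noncomputable def unifMgf (v : ℝ) : ℝ := (1 - Real.exp (-v)) / v

lemma unifMgf_pos {v : ℝ} (hv : 0 < v) : 0 < unifMgf v :=
  div_pos (sub_pos.mpr (Real.exp_zero ▸ Real.exp_lt_exp.mpr (neg_neg_of_pos hv))) hv

lemma unifMgf_eq_integral {v : ℝ} (hv : 0 < v) :
    unifMgf v = ∫ u in (0 : ℝ)..1, Real.exp (-v * u) := by
  rw [intervalIntegral.integral_comp_mul_left (f := Real.exp) (by linarith : -v ≠ 0), integral_exp, unifMgf]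
  simp only [mul_one, mul_zero, Real.exp_zero, smul_eq_mul]
  field_simp
  ring

/-- Jensen's inequality for `x ↦ x^{w/v}`: in probabilistic terms, the `L^p` norms of `e^{-U}`
increase with `p`. -/
lemma unifMgf_le_rpow {v w : ℝ} (hv : 0 < v) (hvw : v ≤ w) :
    unifMgf v ≤ unifMgf w ^ (v / w) := by
  have hw := hv.trans_le hvw
  have hp : 1 ≤ w / v := (one_le_div hv).mpr hvw
  have key : unifMgf v ^ (w / v) ≤ unifMgf w := by
    rw [unifMgf_eq_integral hv, unifMgf_eq_integral hw,
      intervalIntegral.integral_of_le zero_le_one, intervalIntegral.integral_of_le zero_le_one]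
    have : IsProbabilityMeasure ((volume : Measure ℝ).restrict (Set.Ioc 0 1)) := ⟨by simp⟩
    have h := (convexOn_rpow hp).map_integral_le (μ := (volume : Measure ℝ).restrict (Set.Ioc 0 1))
      (f := fun u => Real.exp (-v * u))
      (Real.continuous_rpow_const (by positivity)).continuousOn isClosed_Ici
      (.of_forall fun u => (Real.exp_pos _).le)
      ((by fun_prop : Continuous fun u : ℝ => Real.exp (-v * u)).integrableOn_Ioc)
      (by
        refine Continuous.integrableOn_Ioc ?_
        exact (Real.continuous_rpow_const (by positivity)).comp (by fun_prop))
    refine h.trans_eq (setIntegral_congr_fun measurableSet_Ioc fun u _ => ?_)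
    rw [← Real.exp_mul]
    congr 1
    field_simp
  calc unifMgf v = (unifMgf v ^ (w / v)) ^ (v / w) := by
        rw [← Real.rpow_mul (unifMgf_pos hv).le, div_mul_div_comm, mul_comm w v,
          div_self (by positivity), Real.rpow_one]
    _ ≤ _ := Real.rpow_le_rpow (Real.rpow_nonneg (unifMgf_pos hv).le _) key (by positivity)

/-- The inequality thus propagates from `w` down to every smaller positive `v`. This is what limits
the derivative in Alzer's argument to a single change of sign. -/
lemma unifMgf_pow_le_exp_of_le {k : ℕ} {c v w : ℝ} (hv : 0 < v) (hvw : v ≤ w)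
    (h : unifMgf w ^ k ≤ Real.exp (-(w * c))) : unifMgf v ^ k ≤ Real.exp (-(v * c)) := by
  have hw := hv.trans_le hvw
  calc unifMgf v ^ k ≤ (unifMgf w ^ (v / w)) ^ k :=
        pow_le_pow_left₀ (unifMgf_pos hv).le (unifMgf_le_rpow hv hvw) k
    _ = (unifMgf w ^ k) ^ (v / w) := by
        rw [← Real.rpow_natCast, ← Real.rpow_mul (unifMgf_pos hw).le, mul_comm,
          Real.rpow_mul (unifMgf_pos hw).le, Real.rpow_natCast]
    _ ≤ (Real.exp (-(w * c))) ^ (v / w) :=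
        Real.rpow_le_rpow (pow_nonneg (unifMgf_pos hw).le _) h (by positivity)
    _ = _ := by
        rw [← Real.exp_mul]
        congr 1
        field_simp

lemma cdf_gammaMeasure_eq_intervalIntegral (k : ℕ) {x : ℝ} (hx : 0 ≤ x) :
    cdf (gammaMeasure (k + 1 : ℝ) (k + 1 : ℝ)) x =
      ∫ u in (0 : ℝ)..x, (k + 1 : ℝ) ^ (k + 1) / k.factorial * u ^ k * Real.exp (-((k + 1) * u)) := by
  rw [cdf_gammaMeasure_eq_integral (by positivity) (by positivity),
    intervalIntegral.integral_of_le hx]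
  rw [← integral_Icc_eq_integral_Ioc,
    setIntegral_eq_of_subset_of_forall_sdiff_eq_zero measurableSet_Iic
    (fun u hu => hu.2 : Set.Icc 0 x ⊆ Set.Iic x)]
  · refine setIntegral_congr_fun measurableSet_Icc fun u hu => ?_
    simp only [gammaPDFReal, if_pos hu.1, Real.Gamma_nat_eq_factorial, add_sub_cancel_right,
      Real.rpow_natCast]
    congr 3
    exact_mod_cast Real.rpow_natCast (k + 1 : ℝ) (k + 1)
  · intro u hu
    have : ¬ (0 ≤ u) := fun h0 => hu.2 ⟨h0, hu.1⟩
    simp [gammaPDFReal, this]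

/-- Alzer's lower bound for the regularised incomplete Gamma function. -/
lemma one_sub_exp_pow_le_cdf_gammaMeasure (k : ℕ) {x : ℝ} (hx : 0 ≤ x) :
    (1 - Real.exp (-alzer (k + 1) * x)) ^ (k + 1) ≤
      cdf (gammaMeasure (k + 1 : ℝ) (k + 1 : ℝ)) x := by
  set K : ℝ := k + 1 with hK
  have hK0 : 0 < K := by positivity
  have : IsProbabilityMeasure (gammaMeasure K K) := isProbabilityMeasure_gammaMeasure hK0 hK0
  -- The scale is fixed by `a^K = 1/K!`, which makes the leading constants of the two derivatives at
  -- 0 agree and leaves a common factor to pull out.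
  set a : ℝ := (((k + 1).factorial : ℝ) ^ (1 / K))⁻¹ with ha
  have hfac : (0 : ℝ) < (k + 1).factorial := by positivity
  have ha0 : 0 < a := by positivity
  have hak : a ^ (k + 1) = ((k + 1).factorial : ℝ)⁻¹ := by
    rw [ha, inv_pow, ← Real.rpow_natCast, ← Real.rpow_mul hfac.le]
    push_cast
    rw [one_div, inv_mul_cancel₀ hK0.ne', Real.rpow_one]
  set φ : ℝ := alzer (k + 1) with hφ
  have hφa : φ = K * a := by simp only [hφ, alzer, ha, hK]; push_cast; rw [div_eq_mul_inv]
  have hφ0 : 0 < φ := by rw [hφa]; positivity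
  set f : ℝ → ℝ := fun u => K ^ (k + 1) / k.factorial * u ^ k * Real.exp (-(K * u)) with hf
  set g : ℝ → ℝ := fun y => (∫ u in (0 : ℝ)..y, f u) - (1 - Real.exp (-φ * y)) ^ (k + 1) with hg
  have hfc : Continuous f := by fun_prop
  have hderiv : ∀ y, HasDerivAt g
      (f y - (((k + 1 : ℕ) : ℝ) * (1 - Real.exp (-φ * y)) ^ k * -(Real.exp (-φ * y) * (-φ)))) y := by
    intro y
    refine HasDerivAt.sub (intervalIntegral.integral_hasDerivAt_right
      (hfc.intervalIntegrable _ _) (hfc.stronglyMeasurableAtFilter _ _) hfc.continuousAt) ?_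
    have h1 : HasDerivAt (fun y => 1 - Real.exp (-φ * y)) (-(Real.exp (-φ * y) * (-φ))) y := by
      have := (((hasDerivAt_id y).const_mul (-φ)).exp).const_sub 1
      simpa using this
    exact h1.fun_pow (k + 1)
  -- The derivative of `g` is a nonnegative factor times a difference whose sign is governed by
  -- `unifMgf_pow_le_exp_of_le`: once negative, it remains nonpositive.
  have hsign : ∀ y, 0 < y → f y - (((k + 1 : ℕ) : ℝ) * (1 - Real.exp (-φ * y)) ^ k *
      -(Real.exp (-φ * y) * (-φ))) = K * φ * (φ * y) ^ k * Real.exp (-(φ * y)) *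
        (Real.exp (-((φ * y) * (a⁻¹ - 1))) - unifMgf (φ * y) ^ k) := by
    intro y hy
    have hy' : 0 < φ * y := by positivity
    have e1 : Real.exp (-(K * y)) = Real.exp (-(φ * y)) * Real.exp (-((φ * y) * (a⁻¹ - 1))) := by
      rw [← Real.exp_add]
      congr 1
      have h : φ * a⁻¹ = K := by rw [hφa, mul_assoc, mul_inv_cancel₀ ha0.ne', mul_one]
      linear_combination y * h
    have e2 : K ^ (k + 1) / k.factorial = K * φ * φ ^ k := by
      have : K * φ * φ ^ k = K * (K ^ (k + 1) * a ^ (k + 1)) := by rw [hφa, ← mul_pow, pow_succ]; ring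
      rw [this, hak, Nat.factorial_succ]
      push_cast
      rw [← hK]
      field_simp
    have e3 : (φ * y) ^ k * unifMgf (φ * y) ^ k = (1 - Real.exp (-(φ * y))) ^ k := by
      rw [← mul_pow, unifMgf, mul_div_cancel₀ _ hy'.ne']
    simp only [hf]
    rw [e1, e2, neg_mul, ← e3]
    push_cast
    rw [← hK, mul_pow]
    ring
  have hcoef : ∀ y, 0 < y → 0 ≤ K * φ * (φ * y) ^ k * Real.exp (-(φ * y)) := fun y hy => by
    positivity
  have hgc : Continuous g := continuous_iff_continuousAt.mpr fun y => (hderiv y).continuousAt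
  have hg0 : g 0 = 0 := by simp [hg]
  have hcdf : ∀ y, 0 ≤ y → g y = cdf (gammaMeasure K K) y - (1 - Real.exp (-φ * y)) ^ (k + 1) := by
    intro y hy
    rw [cdf_gammaMeasure_eq_intervalIntegral k hy]
  have hglim : Tendsto g atTop (𝓝 0) := by
    have h1 : Tendsto (fun y => (1 - Real.exp (-φ * y)) ^ (k + 1)) atTop (𝓝 ((1 - 0) ^ (k + 1))) := by
      refine ((tendsto_const_nhds).sub ?_).pow _
      refine Real.tendsto_exp_atBot.comp ?_
      exact tendsto_id.const_mul_atTop_of_neg (by linarith)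
    have h2 := (tendsto_cdf_atTop (gammaMeasure K K)).sub h1
    rw [sub_zero, one_pow, sub_self] at h2
    refine h2.congr' ?_
    filter_upwards [eventually_ge_atTop 0] with y hy
    rw [hcdf y hy]
  suffices h : 0 ≤ g x by
    rw [hcdf x hx] at h
    linarith
  rcases hx.eq_or_lt with rfl | hx0
  · exact hg0.ge
  -- Since `g` vanishes at 0 and at infinity, it suffices to be on either side of the turning point:
  -- either `g` increases from 0 up to `x`, or it decreases from `x` to the limit 0.
  by_cases hc : unifMgf (φ * x) ^ k ≤ Real.exp (-((φ * x) * (a⁻¹ - 1)))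
  · have hmono : MonotoneOn g (Set.Icc 0 x) := by
      refine monotoneOn_of_deriv_nonneg (convex_Icc 0 x) hgc.continuousOn
        (fun y _ => (hderiv y).differentiableAt.differentiableWithinAt) fun y hy => ?_
      rw [interior_Icc] at hy
      rw [(hderiv y).deriv, hsign y hy.1]
      refine mul_nonneg (hcoef y hy.1) (sub_nonneg.mpr ?_)
      exact unifMgf_pow_le_exp_of_le (mul_pos hφ0 hy.1) (by gcongr; exact hy.2.le) hc
    rw [← hg0]
    exact hmono ⟨le_rfl, hx⟩ ⟨hx, le_rfl⟩ hx
  · have hanti : AntitoneOn g (Set.Ici x) := by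
      refine antitoneOn_of_deriv_nonpos (convex_Ici x) hgc.continuousOn
        (fun y _ => (hderiv y).differentiableAt.differentiableWithinAt) fun y hy => ?_
      rw [interior_Ici] at hy
      have hy' : x < y := hy
      have hy0 : 0 < y := hx0.trans hy'
      rw [(hderiv y).deriv, hsign y hy0]
      refine mul_nonpos_of_nonneg_of_nonpos (hcoef y hy0) (sub_nonpos.mpr ?_)
      by_contra hcon
      exact hc (unifMgf_pow_le_exp_of_le (mul_pos hφ0 hx0) (by gcongr) (not_le.mp hcon).le)
    refine le_of_tendsto hglim ?_
    filter_upwards [eventually_ge_atTop x] with y hy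
    exact hanti (Set.mem_Ici.mpr le_rfl) hy hy

/-- The variance, from the Gamma integrals for the moments of order 0, 1 and 2; it feeds Chebyshev's
inequality. -/
lemma lintegral_sub_one_sq_normalizedGamma (k : ℕ) :
    ∫⁻ x, ENNReal.ofReal ((x - 1) ^ 2) ∂normalizedGamma (k + 1) =
      ENNReal.ofReal (1 / (k + 1 : ℝ)) := by
  have hK0 : (0 : ℝ) < ((k + 1 : ℕ) : ℝ) := by positivity
  rw [normalizedGamma, lintegral_gammaMeasure _ _ (by fun_prop)]
  set K : ℝ := ((k + 1 : ℕ) : ℝ) with hK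
  have hint : ∀ j : ℕ, IntegrableOn (fun x : ℝ => x ^ (K + j - 1) * Real.exp (-(K * x))) (Set.Ioi 0) := by
    intro j
    have h := integrableOn_rpow_mul_exp_neg_mul_rpow (s := K + j - 1) (p := 1)
      (by linarith [Nat.cast_nonneg (α := ℝ) j]) one_pos hK0
    simpa using h
  have hval : ∀ j : ℕ, ∫ x in Set.Ioi (0 : ℝ), x ^ (K + j - 1) * Real.exp (-(K * x)) =
      (1 / K) ^ (K + j) * Real.Gamma (K + j) := fun j =>
    Real.integral_rpow_mul_exp_neg_mul_Ioi (by positivity) hK0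
  have hfun : ∀ x ∈ Set.Ioi (0 : ℝ), ENNReal.ofReal (K ^ K / Real.Gamma K * x ^ (K - 1) *
      Real.exp (-(K * x))) * ENNReal.ofReal ((x - 1) ^ 2) =
      ENNReal.ofReal (K ^ K / Real.Gamma K * (x ^ (K + (2 : ℕ) - 1) * Real.exp (-(K * x)) -
        2 * (x ^ (K + (1 : ℕ) - 1) * Real.exp (-(K * x))) +
        x ^ (K + (0 : ℕ) - 1) * Real.exp (-(K * x)))) := by
    intro x hx
    have hx' : (0 : ℝ) < x := hx
    rw [← ENNReal.ofReal_mul (by positivity)]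
    congr 1
    have h2 : x ^ (K + (2 : ℕ) - 1) = x ^ (K - 1) * x ^ 2 := by
      rw [← Real.rpow_natCast x 2, ← Real.rpow_add hx']; congr 1; push_cast; ring
    have h1 : x ^ (K + (1 : ℕ) - 1) = x ^ (K - 1) * x := by
      rw [← Real.rpow_add_one hx'.ne']; congr 1; push_cast; ring
    have h0 : x ^ (K + (0 : ℕ) - 1) = x ^ (K - 1) := by congr 1; push_cast; ring
    rw [h2, h1, h0]
    ring
  rw [setLIntegral_congr_fun measurableSet_Ioi hfun, ← ofReal_integral_eq_lintegral_ofReal]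
  · congr 1
    have hsplit : ∫ x in Set.Ioi (0 : ℝ), (x ^ (K + (2 : ℕ) - 1) * Real.exp (-(K * x)) -
        2 * (x ^ (K + (1 : ℕ) - 1) * Real.exp (-(K * x))) +
        x ^ (K + (0 : ℕ) - 1) * Real.exp (-(K * x))) = _ :=
      integral_add ((hint 2).sub ((hint 1).const_mul 2)) (hint 0)
    rw [integral_const_mul, hsplit]
    rw [integral_sub (hint 2) ((hint 1).const_mul 2), integral_const_mul, hval, hval, hval]
    have hG : 0 < Real.Gamma K := Real.Gamma_pos_of_pos hK0
    have g1 : Real.Gamma (K + (1 : ℕ)) = K * Real.Gamma K := by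
      rw [Nat.cast_one, Real.Gamma_add_one hK0.ne']
    have g2 : Real.Gamma (K + (2 : ℕ)) = (K + 1) * (K * Real.Gamma K) := by
      rw [Nat.cast_two, ← Real.Gamma_add_one hK0.ne', ← Real.Gamma_add_one (by positivity)]
      congr 1; ring
    rw [g1, g2, Nat.cast_zero, add_zero, Real.rpow_add (by positivity), Real.rpow_add (by positivity),
      Real.rpow_natCast _ 2, Real.rpow_natCast _ 1, one_div, Real.inv_rpow hK0.le]
    have : K ^ K ≠ 0 := (Real.rpow_pos_of_pos hK0 _).ne'
    have hk : (k : ℝ) + 1 = K := by rw [hK]; push_cast; rfl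
    rw [hk]
    field_simp
    ring
  · exact (((hint 2).sub ((hint 1).const_mul 2)).add (hint 0)).const_mul _
  · refine (ae_restrict_mem measurableSet_Ioi).mono fun x hx => ?_
    have hx' : (0 : ℝ) < x := hx
    have h2 : x ^ (K + (2 : ℕ) - 1) = x ^ (K - 1) * x ^ 2 := by
      rw [← Real.rpow_natCast x 2, ← Real.rpow_add hx']; congr 1; push_cast; ring
    have h1 : x ^ (K + (1 : ℕ) - 1) = x ^ (K - 1) * x := by
      rw [← Real.rpow_add_one hx'.ne']; congr 1; push_cast; ring
    have h0 : x ^ (K + (0 : ℕ) - 1) = x ^ (K - 1) := by congr 1; push_cast; ring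
    simp only [Pi.zero_apply]
    rw [h2, h1, h0, show x ^ (K - 1) * x ^ 2 * Real.exp (-(K * x)) - 2 * (x ^ (K - 1) * x *
      Real.exp (-(K * x))) + x ^ (K - 1) * Real.exp (-(K * x)) =
      x ^ (K - 1) * Real.exp (-(K * x)) * (x - 1) ^ 2 by ring]
    have := Real.Gamma_pos_of_pos hK0
    positivity

instance isProbabilityMeasure_normalizedGamma_succ (k : ℕ) :
    IsProbabilityMeasure (normalizedGamma (k + 1)) :=
  isProbabilityMeasure_gammaMeasure (by positivity) (by positivity)

lemma normalizedGamma_le_of_dist (k : ℕ) {ε : ℝ} (hε : 0 < ε) :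
    normalizedGamma (k + 1) {x | ε ≤ |x - 1|} ≤ ENNReal.ofReal (1 / (k + 1 : ℝ) / ε ^ 2) := by
  have h := meas_ge_le_lintegral_div (μ := normalizedGamma (k + 1))
    (f := fun x : ℝ => ENNReal.ofReal ((x - 1) ^ 2)) (by fun_prop)
    (ε := ENNReal.ofReal (ε ^ 2)) (by simpa using hε.ne') ENNReal.ofReal_ne_top
  rw [lintegral_sub_one_sq_normalizedGamma, ← ENNReal.ofReal_div_of_pos (by positivity)] at h
  refine (measure_mono fun x hx => ?_).trans h
  have hx' : ε ≤ |x - 1| := hx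
  refine ENNReal.ofReal_le_ofReal ?_
  rw [← sq_abs (x - 1)]
  gcongr

lemma tendsto_normalizedGamma_of_dist {ε : ℝ} (hε : 0 < ε) :
    Tendsto (fun k : ℕ => (normalizedGamma (k + 1)).real {x | ε ≤ |x - 1|}) atTop (𝓝 0) := by
  have h : Tendsto (fun k : ℕ => 1 / ((k : ℝ) + 1) / ε ^ 2) atTop (𝓝 0) := by
    simpa using (tendsto_one_div_add_atTop_nhds_zero_nat (𝕜 := ℝ)).div_const (ε ^ 2)
  refine squeeze_zero (fun _ => measureReal_nonneg) (fun k => ?_) h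
  exact ENNReal.toReal_le_of_le_ofReal (by positivity) (normalizedGamma_le_of_dist k hε)

lemma tendsto_normalizedGamma_Iio_of_lt {x : ℝ} (hx : x < 1) :
    Tendsto (fun k : ℕ => (normalizedGamma (k + 1)).real (Set.Iio x)) atTop (𝓝 0) := by
  refine squeeze_zero (fun _ => measureReal_nonneg) (fun k => ?_)
    (tendsto_normalizedGamma_of_dist (sub_pos.mpr hx))
  refine measureReal_mono fun y hy => ?_
  have hy' : y < x := hy
  simp only [Set.mem_ofPred_eq]
  rw [abs_of_neg (by linarith)]
  linarith

lemma tendsto_normalizedGamma_Iio_of_gt {x : ℝ} (hx : 1 < x) :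
    Tendsto (fun k : ℕ => (normalizedGamma (k + 1)).real (Set.Iio x)) atTop (𝓝 1) := by
  have h : Tendsto (fun k : ℕ => (normalizedGamma (k + 1)).real (Set.Iio x)ᶜ) atTop (𝓝 0) := by
    refine squeeze_zero (fun _ => measureReal_nonneg) (fun k => ?_)
      (tendsto_normalizedGamma_of_dist (sub_pos.mpr hx))
    refine measureReal_mono fun y hy => ?_
    have hy' : x ≤ y := not_lt.mp hy
    simp only [Set.mem_ofPred_eq]
    rw [abs_of_pos (by linarith)]
    linarith
  have h2 := h.const_sub 1
  rw [sub_zero] at h2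
  refine h2.congr fun k => ?_
  rw [probReal_compl_eq_one_sub measurableSet_Iio]
  ring

/-- Alzer's bound in the strict form that the smoothed tail uses; the endpoint is negligible because
the Gamma law has a density. -/
lemma one_sub_exp_pow_le_normalizedGamma {K : ℕ} (hK : 1 ≤ K) {x : ℝ} (hx : 0 ≤ x) :
    (1 - Real.exp (-alzer K * x)) ^ K ≤ (normalizedGamma K).real (Set.Iio x) := by
  obtain ⟨k, rfl⟩ := Nat.exists_eq_add_of_le' hK
  have h := one_sub_exp_pow_le_cdf_gammaMeasure k hx
  have : normalizedGamma (k + 1) = gammaMeasure (k + 1 : ℝ) (k + 1 : ℝ) := by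
    rw [normalizedGamma]; push_cast; rfl
  have hpr : IsProbabilityMeasure (gammaMeasure (k + 1 : ℝ) (k + 1 : ℝ)) :=
    isProbabilityMeasure_gammaMeasure (by positivity) (by positivity)
  rw [this]
  rw [cdf_eq_real] at h
  refine h.trans_eq ?_
  have hna : gammaMeasure (k + 1 : ℝ) (k + 1 : ℝ) {x} = 0 :=
    withDensity_absolutelyContinuous _ _ (by simp)
  exact measureReal_congr (Iio_ae_eq_Iic' hna).symm

/-! ### Complex Gaussian vectors: density, unitary invariance, squared norms. -/

lemma lintegral_pi_prod {n : ℕ} {α : Type*} [MeasurableSpace α] (μ : Fin n → Measure α)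
    [∀ i, SigmaFinite (μ i)] {f : Fin n → α → ℝ≥0∞} (hf : ∀ i, Measurable (f i)) :
    ∫⁻ x, ∏ i, f i (x i) ∂Measure.pi μ = ∏ i, ∫⁻ x, f i x ∂μ i := by
  induction n with
  | zero => simp
  | succ n ih =>
    have h := (measurePreserving_piFinSuccAbove μ 0).symm
    have hm : Measurable fun x : Fin n → α => ∏ i, f i.succ (x i) :=
      Finset.measurable_fun_prod _ fun i _ => (hf _).comp (measurable_pi_apply i)
    have hm' : Measurable fun x : Fin (n + 1) → α => ∏ i, f i (x i) :=
      Finset.measurable_fun_prod _ fun i _ => (hf _).comp (measurable_pi_apply i)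
    rw [← h.lintegral_comp hm']
    simp only [Fin.prod_univ_succ]
    change ∫⁻ a : α × (Fin n → α), f 0 a.1 * ∏ i, f i.succ (a.2 i)
      ∂((μ 0).prod (Measure.pi fun j => μ (Fin.succAbove 0 j))) = _
    rw [lintegral_prod_mul (hf 0).aemeasurable hm.aemeasurable,
      ih (fun j => μ (Fin.succAbove 0 j)) (fun i => hf i.succ)]
    simp

lemma pi_withDensity {n : ℕ} {α : Type*} [MeasurableSpace α] (μ : Measure α) [SigmaFinite μ]
    {f : α → ℝ≥0∞} (hf : Measurable f) [SigmaFinite (μ.withDensity f)] :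
    Measure.pi (fun _ : Fin n => μ.withDensity f) =
      (Measure.pi fun _ : Fin n => μ).withDensity fun x => ∏ i, f (x i) := by
  refine Measure.pi_eq fun s hs => ?_
  rw [withDensity_apply _ (MeasurableSet.univ_pi hs),
    ← lintegral_indicator (MeasurableSet.univ_pi hs)]
  have : ∀ x : Fin n → α, (Set.univ.pi s).indicator (fun x => ∏ i, f (x i)) x =
      ∏ i, (s i).indicator f (x i) := by
    intro x
    by_cases hx : x ∈ Set.univ.pi s
    · rw [Set.indicator_of_mem hx]
      exact Finset.prod_congr rfl fun i _ => (Set.indicator_of_mem (hx i (Set.mem_univ i)) f).symm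
    · rw [Set.indicator_of_notMem hx]
      simp only [Set.mem_pi, Set.mem_univ, true_imp_iff, not_forall] at hx
      obtain ⟨i, hi⟩ := hx
      exact (Finset.prod_eq_zero (Finset.mem_univ i) (Set.indicator_of_notMem hi f)).symm
  simp_rw [this]
  rw [lintegral_pi_prod _ fun i => hf.indicator (hs i)]
  refine Finset.prod_congr rfl fun i _ => ?_
  rw [lintegral_indicator (hs i), withDensity_apply _ (hs i)]

noncomputable def complexGaussianPDF (z : ℂ) : ℝ≥0∞ :=
  ENNReal.ofReal (Real.pi⁻¹ * Real.exp (-‖z‖ ^ 2))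

lemma measurable_complexGaussianPDF : Measurable complexGaussianPDF := by
  unfold complexGaussianPDF; fun_prop

lemma stdComplexGaussian_eq_withDensity :
    stdComplexGaussian = (volume : Measure ℂ).withDensity complexGaussianPDF := by
  have hv : (1 / 2 : ℝ≥0) ≠ 0 := by norm_num
  have hvp := Complex.volume_preserving_equiv_real_prod.symm
  have hfun : (fun p : ℝ × ℝ => (⟨p.1, p.2⟩ : ℂ)) = Complex.measurableEquivRealProd.symm := by
    ext p; rfl
  rw [stdComplexGaussian, gaussianReal_of_var_ne_zero _ hv,
    prod_withDensity (measurable_gaussianPDF _ _) (measurable_gaussianPDF _ _), hfun]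
  ext s hs
  rw [Measure.map_apply (Complex.measurableEquivRealProd.symm.measurable) hs,
    withDensity_apply _ (Complex.measurableEquivRealProd.symm.measurable hs),
    withDensity_apply _ hs, ← hvp.setLIntegral_comp_preimage hs measurable_complexGaussianPDF]
  refine setLIntegral_congr_fun (Complex.measurableEquivRealProd.symm.measurable hs) fun p _ => ?_
  simp only [gaussianPDF, complexGaussianPDF, gaussianPDFReal]
  rw [← ENNReal.ofReal_mul (by positivity)]
  congr 1
  have hn : ‖Complex.measurableEquivRealProd.symm p‖ ^ 2 = p.1 ^ 2 + p.2 ^ 2 := by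
    rw [← Complex.normSq_eq_norm_sq, Complex.normSq_apply]
    simp [sq]
  rw [hn]
  push_cast
  have h2 : (2 : ℝ) * Real.pi * (1 / 2) = Real.pi := by ring
  rw [h2, mul_mul_mul_comm, ← mul_inv, Real.mul_self_sqrt Real.pi_pos.le, ← Real.exp_add]
  congr 2
  ring

instance isProbabilityMeasure_stdComplexGaussian : IsProbabilityMeasure stdComplexGaussian :=
  Measure.isProbabilityMeasure_map
    (Measurable.aemeasurable Complex.measurableEquivRealProd.symm.measurable)

noncomputable def complexGaussianVecPDF {n : ℕ} (h : Fin n → ℂ) : ℝ≥0∞ :=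
  ENNReal.ofReal (Real.pi⁻¹ ^ n * Real.exp (-∑ i, ‖h i‖ ^ 2))

lemma measurable_complexGaussianVecPDF {n : ℕ} :
    Measurable (complexGaussianVecPDF : (Fin n → ℂ) → ℝ≥0∞) := by
  unfold complexGaussianVecPDF; fun_prop

lemma pi_stdComplexGaussian_eq_withDensity (n : ℕ) :
    Measure.pi (fun _ : Fin n => stdComplexGaussian) =
      (volume : Measure (Fin n → ℂ)).withDensity complexGaussianVecPDF := by
  have : SigmaFinite ((volume : Measure ℂ).withDensity complexGaussianPDF) := by
    rw [← stdComplexGaussian_eq_withDensity]; infer_instance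
  simp_rw [stdComplexGaussian_eq_withDensity]
  rw [pi_withDensity _ measurable_complexGaussianPDF, volume_pi]
  congr 1
  ext h
  simp only [complexGaussianPDF, complexGaussianVecPDF]
  rw [← ENNReal.ofReal_prod_of_nonneg (fun i _ => by positivity), Finset.prod_mul_distrib,
    Finset.prod_const, ← Real.exp_sum, Finset.card_univ, Fintype.card_fin, Finset.sum_neg_distrib]

/-- The density depends only on the preserved quadratic form, and a linear bijection scales Lebesgue
measure by some constant. Equality of total masses forces this constant to be 1, so no determinant
is computed. -/
lemma map_linearEquiv_pi_stdComplexGaussian {n : ℕ} (L : (Fin n → ℂ) ≃ₗ[ℂ] (Fin n → ℂ))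
    (hL : ∀ h, ∑ i, ‖L h i‖ ^ 2 = ∑ i, ‖h i‖ ^ 2) :
    (Measure.pi (fun _ : Fin n => stdComplexGaussian)).map L =
      Measure.pi (fun _ : Fin n => stdComplexGaussian) := by
  set f : (Fin n → ℂ) ≃ₗ[ℝ] (Fin n → ℂ) := L.restrictScalars ℝ with hf
  have hfL : ∀ h, f h = L h := fun _ => rfl
  have hmeas : Measurable L := by
    have : Measurable (f : (Fin n → ℂ) →ₗ[ℝ] (Fin n → ℂ)) :=
      (LinearMap.continuous_of_finiteDimensional _).measurable
    exact this
  obtain ⟨c, hc⟩ : ∃ c : ℝ≥0∞, (volume : Measure (Fin n → ℂ)).map L = c • volume :=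
    ⟨_, Measure.map_linearMap_addHaar_eq_smul_addHaar (f := (f : (Fin n → ℂ) →ₗ[ℝ] (Fin n → ℂ)))
      (volume : Measure (Fin n → ℂ)) (LinearEquiv.isUnit_det' f).ne_zero⟩
  have hdens : ∀ h, complexGaussianVecPDF (L h) = complexGaussianVecPDF h := fun h => by
    simp only [complexGaussianVecPDF, hL]
  set μ := Measure.pi (fun _ : Fin n => stdComplexGaussian) with hμ
  have key : μ.map L = c • μ := by
    rw [hμ, pi_stdComplexGaussian_eq_withDensity]
    ext s hs
    rw [Measure.map_apply hmeas hs, withDensity_apply _ (hmeas hs), Measure.smul_apply,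
      withDensity_apply _ hs]
    have h1 := setLIntegral_map (μ := (volume : Measure (Fin n → ℂ))) hs
      measurable_complexGaussianVecPDF hmeas
    simp only [hdens] at h1
    rw [← h1, hc, Measure.restrict_smul, lintegral_smul_measure]
  have hone : c = 1 := by
    have h1 : (μ.map L) Set.univ = 1 := by
      rw [Measure.map_apply hmeas MeasurableSet.univ, Set.preimage_univ, measure_univ]
    rw [key, Measure.smul_apply, measure_univ, smul_eq_mul, mul_one] at h1
    exact h1
  rw [key, hone, one_smul]

lemma lintegral_fun_norm_addHaar {E : Type*} [NormedAddCommGroup E] [NormedSpace ℝ E]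
    [MeasurableSpace E] [BorelSpace E] [FiniteDimensional ℝ E] [Nontrivial E]
    (ν : Measure E) [ν.IsAddHaarMeasure] {f : ℝ → ℝ≥0∞} (hf : Measurable f) :
    ∫⁻ x, f ‖x‖ ∂ν = ν.toSphere Set.univ *
      ∫⁻ y in Set.Ioi (0 : ℝ), ENNReal.ofReal (y ^ (Module.finrank ℝ E - 1)) * f y := by
  have hmeas : Measurable fun r : Set.Ioi (0 : ℝ) =>
      ENNReal.ofReal (r.1 ^ (Module.finrank ℝ E - 1)) := by fun_prop
  calc ∫⁻ x, f ‖x‖ ∂ν = ∫⁻ x : ({0}ᶜ : Set E), f ‖x.1‖ ∂(ν.comap (↑)) := by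
        rw [lintegral_subtype_comap (measurableSet_singleton _).compl fun x => f ‖x‖,
          restrict_compl_singleton]
    _ = ∫⁻ x, f x.2 ∂ν.toSphere.prod (Measure.volumeIoiPow (Module.finrank ℝ E - 1)) := by
        rw [← ν.measurePreserving_homeomorphUnitSphereProd.lintegral_comp (by fun_prop)]
        simp only [homeomorphUnitSphereProd_apply_snd_coe]
    _ = ν.toSphere Set.univ *
        ∫⁻ x : Set.Ioi (0 : ℝ), f x ∂Measure.volumeIoiPow (Module.finrank ℝ E - 1) := by
        rw [lintegral_prod _ (by fun_prop)]
        simp [mul_comm]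
    _ = _ := by
        rw [Measure.volumeIoiPow, lintegral_withDensity_eq_lintegral_mul _ hmeas (by fun_prop)]
        congr 1
        exact lintegral_subtype_comap measurableSet_Ioi
          (fun y => ENNReal.ofReal (y ^ (Module.finrank ℝ E - 1)) * f y)

lemma lintegral_comp_sq_Ioi (g : ℝ → ℝ≥0∞) :
    ∫⁻ u in Set.Ioi (0 : ℝ), g u = ∫⁻ y in Set.Ioi (0 : ℝ), ENNReal.ofReal (2 * y) * g (y ^ 2) := by
  have himg : (fun y : ℝ => y ^ 2) '' Set.Ioi 0 = Set.Ioi 0 := by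
    ext u
    constructor
    · rintro ⟨y, hy, rfl⟩
      exact pow_pos (Set.mem_Ioi.mp hy) 2
    · intro hu
      exact ⟨√u, Real.sqrt_pos.mpr hu, Real.sq_sqrt (le_of_lt hu)⟩
  have h := lintegral_image_eq_lintegral_abs_deriv_mul (s := Set.Ioi (0 : ℝ))
    (f := fun y : ℝ => y ^ 2) (f' := fun y => 2 * y) measurableSet_Ioi
    (fun y _ => by simpa using (hasDerivAt_pow 2 y).hasDerivWithinAt)
    (fun x hx y hy hxy => by
      exact (pow_left_inj₀ (le_of_lt hx) (le_of_lt hy) two_ne_zero).mp hxy) g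
  rw [himg] at h
  rw [h]
  refine setLIntegral_congr_fun measurableSet_Ioi fun y hy => ?_
  rw [abs_of_pos (mul_pos two_pos hy)]

/-- In polar coordinates the radial weight `r^{2k+1} e^{-r²}` becomes `u^k e^{-u}` under `u = r²`,
so the two laws are proportional. Both have mass 1, which removes the need for the area of the
sphere or the value of `C`. -/
lemma lintegral_norm_sq_gaussian {E : Type*} [NormedAddCommGroup E] [NormedSpace ℝ E]
    [MeasurableSpace E] [BorelSpace E] [FiniteDimensional ℝ E]
    (ν : Measure E) [ν.IsAddHaarMeasure] {k : ℕ} (hk : Module.finrank ℝ E = 2 * (k + 1)) {C : ℝ}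
    (hC : 0 ≤ C)
    (hprob : IsProbabilityMeasure (ν.withDensity fun x => ENNReal.ofReal (C * Real.exp (-‖x‖ ^ 2))))
    {f : ℝ → ℝ≥0∞} (hf : Measurable f) :
    ∫⁻ x, f (‖x‖ ^ 2) ∂(ν.withDensity fun x => ENNReal.ofReal (C * Real.exp (-‖x‖ ^ 2))) =
      ∫⁻ u, f u ∂gammaMeasure (k + 1) 1 := by
  have : Nontrivial E := Module.nontrivial_of_finrank_pos (R := ℝ) (by omega)
  have hpr : IsProbabilityMeasure (gammaMeasure (k + 1 : ℝ) 1) :=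
    isProbabilityMeasure_gammaMeasure (by positivity) one_pos
  have key : ∃ c : ℝ≥0∞, ∀ f : ℝ → ℝ≥0∞, Measurable f →
      ∫⁻ x, f (‖x‖ ^ 2) ∂(ν.withDensity fun x => ENNReal.ofReal (C * Real.exp (-‖x‖ ^ 2))) =
        c * ∫⁻ u, f u ∂gammaMeasure (k + 1) 1 := by
    refine ⟨ν.toSphere Set.univ * ENNReal.ofReal (C * Real.Gamma (k + 1) / 2), fun f hf => ?_⟩
    rw [lintegral_withDensity_eq_lintegral_mul _ (by fun_prop) (by fun_prop)]
    change ∫⁻ x, (fun r : ℝ => ENNReal.ofReal (C * Real.exp (-r ^ 2)) * f (r ^ 2)) ‖x‖ ∂ν = _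
    rw [lintegral_fun_norm_addHaar ν
      (f := fun r : ℝ => ENNReal.ofReal (C * Real.exp (-r ^ 2)) * f (r ^ 2)) (by fun_prop), lintegral_gammaMeasure _ _ hf,
      lintegral_comp_sq_Ioi (fun u => ENNReal.ofReal ((1 : ℝ) ^ ((k : ℝ) + 1) / Real.Gamma (k + 1) *
        u ^ ((k : ℝ) + 1 - 1) * Real.exp (-(1 * u))) * f u), mul_assoc, ← lintegral_const_mul' _ _ ENNReal.ofReal_ne_top]
    congr 1
    refine setLIntegral_congr_fun measurableSet_Ioi fun y hy => ?_
    have hy' : (0 : ℝ) < y := hy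
    rw [← mul_assoc, ← mul_assoc, ← mul_assoc, ← ENNReal.ofReal_mul (by positivity),
      ← ENNReal.ofReal_mul (by positivity),  ← ENNReal.ofReal_mul (by positivity)]
    congr 2
    have hG : 0 < Real.Gamma (k + 1) := Real.Gamma_pos_of_pos (by positivity)
    rw [hk, Real.one_rpow, add_sub_cancel_right, Real.rpow_natCast, one_mul,
      show 2 * (k + 1) - 1 = 2 * k + 1 by omega, ← pow_mul]
    field_simp
    ring
  obtain ⟨c, hc⟩ := key
  have h1 := hc (fun _ => 1) measurable_const
  simp only [lintegral_const, measure_univ, mul_one] at h1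
  rw [hc f hf, ← h1, one_mul]

lemma lintegral_l2norm_sq_pi_stdComplexGaussian (k : ℕ) {f : ℝ → ℝ≥0∞} (hf : Measurable f) :
    ∫⁻ h, f (l2norm h ^ 2) ∂Measure.pi (fun _ : Fin (k + 1) => stdComplexGaussian) =
      ∫⁻ u, f u ∂gammaMeasure (k + 1) 1 := by
  let e : (Fin (k + 1) → ℂ) ≃L[ℝ] EuclideanSpace ℂ (Fin (k + 1)) :=
    (PiLp.continuousLinearEquiv 2 ℝ fun _ : Fin (k + 1) => ℂ).symm
  have he : ∀ h, e h = WithLp.toLp 2 h := fun _ => rfl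
  have hn : ∀ h, ‖e h‖ ^ 2 = ∑ i, ‖h i‖ ^ 2 := fun h => by
    rw [EuclideanSpace.norm_sq_eq]; rfl
  have hme : MeasurableEmbedding e := e.toHomeomorph.measurableEmbedding
  set ν : Measure (EuclideanSpace ℂ (Fin (k + 1))) := (volume : Measure (Fin (k + 1) → ℂ)).map e with hν
  have hdens : (Measure.pi (fun _ : Fin (k + 1) => stdComplexGaussian)).map e =
      ν.withDensity fun x => ENNReal.ofReal (Real.pi⁻¹ ^ (k + 1) * Real.exp (-‖x‖ ^ 2)) := by
    rw [pi_stdComplexGaussian_eq_withDensity]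
    ext s hs
    rw [Measure.map_apply hme.measurable hs, withDensity_apply _ (hme.measurable hs),
      withDensity_apply _ hs, hν, setLIntegral_map hs (by fun_prop) hme.measurable]
    simp only [complexGaussianVecPDF, hn]
  have hprob : IsProbabilityMeasure
      (ν.withDensity fun x => ENNReal.ofReal (Real.pi⁻¹ ^ (k + 1) * Real.exp (-‖x‖ ^ 2))) := by
    rw [← hdens]; exact Measure.isProbabilityMeasure_map hme.measurable.aemeasurable
  have hfr : Module.finrank ℝ (EuclideanSpace ℂ (Fin (k + 1))) = 2 * (k + 1) := by
    rw [← e.toLinearEquiv.finrank_eq, Module.finrank_pi_fintype]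
    simp [Complex.finrank_real_complex, mul_comm]
  have := lintegral_norm_sq_gaussian ν hfr (by positivity) hprob hf
  rw [← this, ← hdens, lintegral_map (by fun_prop) hme.measurable]
  rfl

lemma lintegral_norm_sq_stdComplexGaussian {f : ℝ → ℝ≥0∞} (hf : Measurable f) :
    ∫⁻ z, f (‖z‖ ^ 2) ∂stdComplexGaussian = ∫⁻ u, f u ∂gammaMeasure 1 1 := by
  have hprob : IsProbabilityMeasure ((volume : Measure ℂ).withDensity
      fun x => ENNReal.ofReal (Real.pi⁻¹ * Real.exp (-‖x‖ ^ 2))) := by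
    have := stdComplexGaussian_eq_withDensity ▸ isProbabilityMeasure_stdComplexGaussian
    exact this
  have := lintegral_norm_sq_gaussian (volume : Measure ℂ) (k := 0)
    (by simp [Complex.finrank_real_complex]) (by positivity) hprob hf
  rw [stdComplexGaussian_eq_withDensity]
  rw [Nat.cast_zero, zero_add] at this
  exact this

lemma sum_norm_sq_eq_dotProduct {n : ℕ} (v : Fin n → ℂ) :
    ((∑ i, ‖v i‖ ^ 2 : ℝ) : ℂ) = star v ⬝ᵥ v := by
  simp only [dotProduct, Pi.star_apply, RCLike.star_def, Complex.conj_mul']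
  push_cast
  rfl

/-- The projections of a standard complex Gaussian vector on the beamformer and on the
artificial-noise space have independent exponential and Gamma distributed powers. -/
lemma lintegral_projections_pi_stdComplexGaussian (k : ℕ) {w : Fin (k + 2) → ℂ}
    {G : Matrix (Fin (k + 2)) (Fin (k + 1)) ℂ} (hw : star w ⬝ᵥ w = 1) (hG : Gᴴ * G = 1)
    (hGw : Gᴴ *ᵥ w = 0) {F : ℝ → ℝ → ℝ≥0∞} (hF : Measurable (Function.uncurry F)) :
    ∫⁻ h, F (‖w ⬝ᵥ h‖ ^ 2) (l2norm (h ᵥ* G) ^ 2) ∂Measure.pi (fun _ : Fin (k + 2) => stdComplexGaussian)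
      = ∫⁻ b, ∫⁻ a, F a b ∂gammaMeasure 1 1 ∂gammaMeasure (k + 1) 1 := by
  -- The rows of `A` are `w` and the columns of `G`, without conjugation, so that `A h` lists `wᵀh`
  -- followed by `hᵀG`; orthonormality says that `A` is unitary.
  let A : Matrix (Fin (k + 2)) (Fin (k + 2)) ℂ := Matrix.of (Fin.cons w fun j i => G i j)
  have hA0 : ∀ h, (A *ᵥ h) 0 = w ⬝ᵥ h := fun h => rfl
  have hAs : ∀ h j, (A *ᵥ h) (Fin.succ j) = (h ᵥ* G) j := fun h j => by
    simp [A, Matrix.mulVec, Matrix.vecMul, dotProduct, mul_comm]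
  have hAA : A * Aᴴ = 1 := by
    ext i j
    refine Fin.cases ?_ (fun i => ?_) i <;> refine Fin.cases ?_ (fun j => ?_) j
    · simpa [A, Matrix.mul_apply, dotProduct, mul_comm] using hw
    · have := congrFun hGw j
      rw [Matrix.one_apply_ne (Fin.succ_ne_zero j).symm]
      simpa [A, Matrix.mul_apply, Matrix.mulVec, dotProduct, mul_comm] using this
    · have := congrArg star (congrFun hGw i)
      rw [Matrix.one_apply_ne (Fin.succ_ne_zero i)]
      simpa [A, Matrix.mul_apply, Matrix.mulVec, dotProduct, mul_comm] using this
    · have := congrFun (congrFun hG j) i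
      simpa [A, Matrix.mul_apply, Matrix.one_apply, mul_comm, eq_comm] using this
  have hAA' : Aᴴ * A = 1 := mul_eq_one_comm.mp hAA
  let L : (Fin (k + 2) → ℂ) ≃ₗ[ℂ] (Fin (k + 2) → ℂ) := Matrix.toLin'OfInv hAA' hAA
  have hLA : ∀ h, L h = A *ᵥ h := fun h => rfl
  have hL : ∀ h, ∑ i, ‖L h i‖ ^ 2 = ∑ i, ‖h i‖ ^ 2 := by
    intro h
    have : ((∑ i, ‖L h i‖ ^ 2 : ℝ) : ℂ) = ((∑ i, ‖h i‖ ^ 2 : ℝ) : ℂ) := by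
      rw [sum_norm_sq_eq_dotProduct, sum_norm_sq_eq_dotProduct, hLA, Matrix.star_mulVec,
        Matrix.dotProduct_mulVec, Matrix.vecMul_vecMul, hAA', Matrix.vecMul_one]
    exact_mod_cast this
  have hmap := map_linearEquiv_pi_stdComplexGaussian L hL
  have hLm : Measurable L := by
    have : Measurable fun h : Fin (k + 2) → ℂ => A *ᵥ h :=
      (Continuous.matrix_mulVec continuous_const continuous_id).measurable
    exact this
  have hl2 : Measurable (l2norm : (Fin (k + 1) → ℂ) → ℝ) := by
    unfold l2norm; fun_prop
  have hFm : Measurable fun h : Fin (k + 2) → ℂ => F (‖h 0‖ ^ 2) (l2norm (fun j => h (Fin.succ j)) ^ 2) := by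
    refine hF.comp (Measurable.prodMk (by fun_prop) ?_)
    exact (hl2.comp (by fun_prop)).pow_const 2
  calc ∫⁻ h, F (‖w ⬝ᵥ h‖ ^ 2) (l2norm (h ᵥ* G) ^ 2) ∂Measure.pi (fun _ : Fin (k + 2) => stdComplexGaussian)
      = ∫⁻ h, (fun h : Fin (k + 2) → ℂ => F (‖h 0‖ ^ 2) (l2norm (fun j => h (Fin.succ j)) ^ 2)) (L h)
          ∂Measure.pi (fun _ : Fin (k + 2) => stdComplexGaussian) := by
        refine lintegral_congr fun h => ?_
        simp only [hLA, hA0, hAs]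
    _ = ∫⁻ h, F (‖h 0‖ ^ 2) (l2norm (fun j => h (Fin.succ j)) ^ 2)
          ∂Measure.pi (fun _ : Fin (k + 2) => stdComplexGaussian) := by
        rw [← lintegral_map hFm hLm, hmap]
    _ = ∫⁻ p : ℂ × (Fin (k + 1) → ℂ), F (‖p.1‖ ^ 2) (l2norm p.2 ^ 2) ∂stdComplexGaussian.prod
          (Measure.pi (fun _ : Fin (k + 1) => stdComplexGaussian)) := by
        rw [← (measurePreserving_piFinSuccAbove (fun _ : Fin (k + 2) => stdComplexGaussian)
          0).symm.lintegral_comp hFm]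
        simp only [MeasurableEquiv.piFinSuccAbove_symm_apply, Fin.insertNthEquiv,
          Equiv.coe_fn_mk, Fin.insertNth_zero, Fin.cons_zero, Fin.cons_succ]
        rfl
    _ = _ := by
        rw [lintegral_prod_symm _ (by
          refine (hF.comp (Measurable.prodMk (by fun_prop) ?_)).aemeasurable
          exact (hl2.comp (by fun_prop)).pow_const 2)]
        have : ∀ y, ∫⁻ x, F (‖x‖ ^ 2) y ∂stdComplexGaussian = ∫⁻ a, F a y ∂gammaMeasure 1 1 := fun y =>
          lintegral_norm_sq_stdComplexGaussian (f := fun a => F a y)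
            (hF.comp (measurable_id.prodMk measurable_const))
        simp only [this]
        have hpr : IsProbabilityMeasure (gammaMeasure 1 1) :=
          isProbabilityMeasure_gammaMeasure one_pos one_pos
        have hm : Measurable fun b => ∫⁻ a, F a b ∂gammaMeasure 1 1 := hF.lintegral_prod_left'
        exact lintegral_l2norm_sq_pi_stdComplexGaussian k hm

/-! ### The exponent: integrating the mark transform over the plane. -/

lemma lintegral_rpow_mul_exp_neg_mul_rpow {p q b : ℝ} (hp : 0 < p) (hq : -1 < q) (hb : 0 < b) :
    ∫⁻ y in Set.Ioi (0 : ℝ), ENNReal.ofReal (y ^ q * Real.exp (-b * y ^ p)) =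
      ENNReal.ofReal (b ^ (-(q + 1) / p) * (1 / p) * Real.Gamma ((q + 1) / p)) := by
  rw [← integral_rpow_mul_exp_neg_mul_rpow hp hq hb, ofReal_integral_eq_lintegral_ofReal]
  · exact integrableOn_rpow_mul_exp_neg_mul_rpow hq hp hb
  · refine (ae_restrict_mem measurableSet_Ioi).mono fun y hy => ?_
    have : (0 : ℝ) < y := hy
    simp only [Pi.zero_apply]
    positivity

lemma lintegral_rpow_mul_exp_neg_mul {a r : ℝ} (ha : 0 < a) (hr : 0 < r) :
    ∫⁻ t in Set.Ioi (0 : ℝ), ENNReal.ofReal (t ^ (a - 1) * Real.exp (-r * t)) =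
      ENNReal.ofReal (r ^ (-a) * Real.Gamma a) := by
  have h := lintegral_rpow_mul_exp_neg_mul_rpow (p := 1) (q := a - 1) one_pos (by linarith) hr
  simpa using h

lemma lintegral_exp_neg_mul {r : ℝ} (hr : 0 < r) :
    ∫⁻ t in Set.Ioi (0 : ℝ), ENNReal.ofReal (Real.exp (-r * t)) = ENNReal.ofReal r⁻¹ := by
  have h := lintegral_rpow_mul_exp_neg_mul one_pos hr
  simpa [Real.rpow_neg_one] using h

lemma ae_pos_gammaMeasure (a r : ℝ) : ∀ᵐ b ∂gammaMeasure a r, 0 < b := by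
  rw [ae_iff]
  have h := lintegral_gammaMeasure a r
    ((measurable_const (a := (1 : ℝ≥0∞))).indicator (measurableSet_Iic (a := (0 : ℝ))))
  rw [lintegral_indicator measurableSet_Iic, setLIntegral_const, one_mul] at h
  have hset : {b : ℝ | ¬ 0 < b} = Set.Iic 0 := by ext b; simp
  rw [hset, h]
  refine (setLIntegral_congr_fun measurableSet_Ioi fun x hx => ?_).trans (lintegral_zero)
  rw [Set.indicator_of_notMem (by simpa using hx), mul_zero]

lemma lintegral_exp_neg_gammaMeasure_one {θ : ℝ} (hθ : 0 ≤ θ) :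
    ∫⁻ a, ENNReal.ofReal (Real.exp (-(θ * a))) ∂gammaMeasure 1 1 = ENNReal.ofReal (1 + θ)⁻¹ := by
  rw [lintegral_gammaMeasure _ _ (by fun_prop), ← lintegral_exp_neg_mul (by linarith)]
  refine setLIntegral_congr_fun measurableSet_Ioi fun a ha => ?_
  simp only [Real.one_rpow, Real.Gamma_one, sub_self, Real.rpow_zero, one_mul, div_one]
  rw [← ENNReal.ofReal_mul (Real.exp_pos _).le, ← Real.exp_add]
  congr 2; ring

/-- The spatial integral of the rational kernel of the path loss. -/
lemma lintegral_plane_div_rpow_add {η q c : ℝ} (hη : 2 < η) (hq : 0 < q) (hc : 0 < c) :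
    ∫⁻ x : Plane, ENNReal.ofReal (q / (‖x‖ ^ η + c)) =
      ENNReal.ofReal (2 * Real.pi * (beta (2 / η) (1 - 2 / η) / η) * q * c ^ (2 / η - 1)) := by
  have hη0 : 0 < η := by linarith
  have hδ0 : 0 < 2 / η := by positivity
  have hδ1 : 2 / η < 1 := (div_lt_one hη0).mpr hη
  have hsph : (volume : Measure Plane).toSphere Set.univ = ENNReal.ofReal (2 * Real.pi) := by
    rw [Measure.toSphere_apply_univ, EuclideanSpace.volume_ball_fin_two,
      ENNReal.ofReal_mul two_pos.le]
    simp
  rw [lintegral_fun_norm_addHaar (volume : Measure Plane)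
    (f := fun r => ENNReal.ofReal (q / (r ^ η + c))) (by fun_prop), hsph]
  -- Writing `1/(y^η + c)` as `∫ e^{-(y^η + c)t} dt` and exchanging the integrals reduces everything
  -- to two Gamma integrals. Their product is a Beta value because the parameters add up to 1.
  have h1 : ∀ y ∈ Set.Ioi (0 : ℝ),
      ENNReal.ofReal (y ^ (Module.finrank ℝ Plane - 1)) * ENNReal.ofReal (q / (y ^ η + c)) =
      ∫⁻ t in Set.Ioi (0 : ℝ), ENNReal.ofReal (q * y) * ENNReal.ofReal (Real.exp (-(y ^ η + c) * t)) := by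
    intro y hy
    have hy' : (0 : ℝ) < y := hy
    rw [lintegral_const_mul' _ _ ENNReal.ofReal_ne_top, lintegral_exp_neg_mul (by positivity),
      ← ENNReal.ofReal_mul (by positivity), ← ENNReal.ofReal_mul (by positivity)]
    congr 1
    rw [finrank_euclideanSpace_fin]
    ring
  rw [setLIntegral_congr_fun measurableSet_Ioi h1, lintegral_lintegral_swap (by
    refine Measurable.aemeasurable ?_
    simp only [Function.uncurry_def]
    fun_prop)]
  have h2 : ∀ t ∈ Set.Ioi (0 : ℝ), ∫⁻ y in Set.Ioi (0 : ℝ),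
      ENNReal.ofReal (q * y) * ENNReal.ofReal (Real.exp (-(y ^ η + c) * t)) =
      ENNReal.ofReal (q * (1 / η) * Real.Gamma (2 / η)) *
        ENNReal.ofReal (t ^ ((1 - 2 / η) - 1) * Real.exp (-c * t)) := by
    intro t ht
    have ht' : (0 : ℝ) < t := ht
    have h3 := lintegral_rpow_mul_exp_neg_mul_rpow (p := η) (q := 1) hη0 (by norm_num) ht'
    have h4 : ∀ y ∈ Set.Ioi (0 : ℝ), ENNReal.ofReal (q * y) *
        ENNReal.ofReal (Real.exp (-(y ^ η + c) * t)) = ENNReal.ofReal (q * Real.exp (-c * t)) *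
        ENNReal.ofReal (y ^ (1 : ℝ) * Real.exp (-t * y ^ η)) := by
      intro y hy
      have hy' : (0 : ℝ) < y := hy
      rw [← ENNReal.ofReal_mul (by positivity), ← ENNReal.ofReal_mul (by positivity), Real.rpow_one,
        show -(y ^ η + c) * t = -c * t + -t * y ^ η by ring, Real.exp_add]
      congr 1; ring
    rw [setLIntegral_congr_fun measurableSet_Ioi h4,
      lintegral_const_mul' _ _ ENNReal.ofReal_ne_top, h3, ← ENNReal.ofReal_mul (by positivity),
      ← ENNReal.ofReal_mul (mul_nonneg (by positivity) (Real.Gamma_pos_of_pos hδ0).le)]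
    congr 1
    rw [show -(1 + 1) / η = 1 - 2 / η - 1 by ring, show ((1 : ℝ) + 1) / η = 2 / η by norm_num]
    ring
  rw [setLIntegral_congr_fun measurableSet_Ioi h2, lintegral_const_mul' _ _ ENNReal.ofReal_ne_top,
    lintegral_rpow_mul_exp_neg_mul (by linarith) hc,
    ← ENNReal.ofReal_mul (mul_nonneg (by positivity) (Real.Gamma_pos_of_pos hδ0).le),
    ← ENNReal.ofReal_mul (by positivity)]
  congr 1
  rw [beta, show 2 / η + (1 - 2 / η) = 1 by ring, Real.Gamma_one,
    show -(1 - 2 / η) = 2 / η - 1 by ring]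
  ring

/-- The substitution `b = (q/ϱ) t` turns `ϱ b + q` into `q (1 + t)`, which produces the Tricomi
integrand. -/
lemma lintegral_rpow_gammaMeasure (k : ℕ) (δ : ℝ) {ϱ q : ℝ} (hϱ : 0 < ϱ) (hq : 0 < q) :
    ∫⁻ b, ENNReal.ofReal ((ϱ * b + q) ^ (δ - 1)) ∂gammaMeasure (k + 1) 1 =
      ENNReal.ofReal ((k.factorial : ℝ)⁻¹ * (q / ϱ) ^ (k + 1) * q ^ (δ - 1) *
        ∫ t in Set.Ioi (0 : ℝ), t ^ k * (1 + t) ^ (δ - 1) * Real.exp (-(q / ϱ * t))) := by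
  set z := q / ϱ with hz
  have hz0 : 0 < z := by positivity
  rw [lintegral_gammaMeasure _ _ (by fun_prop)]
  set g : ℝ → ℝ := fun b => b ^ k * Real.exp (-b) * (ϱ * b + q) ^ (δ - 1) with hg
  have hcomp : ∀ t ∈ Set.Ioi (0 : ℝ), g (z * t) = z ^ k * q ^ (δ - 1) *
      (t ^ k * (1 + t) ^ (δ - 1) * Real.exp (-(z * t))) := by
    intro t ht
    have ht' : (0 : ℝ) < t := ht
    have : ϱ * (z * t) + q = q * (1 + t) := by rw [hz]; field_simp; ring
    simp only [hg]
    rw [this, Real.mul_rpow hq.le (by positivity), mul_pow]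
    ring
  have hint : IntegrableOn g (Set.Ioi 0) := by
    have h1 : IntegrableOn (fun t => g (z * t)) (Set.Ioi 0) :=
      (integrableOn_congr_fun hcomp measurableSet_Ioi).mpr
        ((integrableOn_pow_mul_one_add_rpow k δ hz0).const_mul _)
    have := (integrableOn_Ioi_comp_mul_left_iff g 0 hz0).mp h1
    simpa using this
  have hval : ∫ b in Set.Ioi (0 : ℝ), g b = z * (z ^ k * q ^ (δ - 1) *
      ∫ t in Set.Ioi (0 : ℝ), t ^ k * (1 + t) ^ (δ - 1) * Real.exp (-(z * t))) := by
    have h1 := integral_comp_mul_left_Ioi g 0 hz0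
    rw [setIntegral_congr_fun measurableSet_Ioi hcomp, integral_const_mul, mul_zero,
      smul_eq_mul] at h1
    rw [h1]
    field_simp
  have h2 : ∀ b ∈ Set.Ioi (0 : ℝ), ENNReal.ofReal ((1 : ℝ) ^ ((k : ℝ) + 1) / Real.Gamma (k + 1) *
      b ^ ((k : ℝ) + 1 - 1) * Real.exp (-(1 * b))) * ENNReal.ofReal ((ϱ * b + q) ^ (δ - 1)) =
      ENNReal.ofReal ((k.factorial : ℝ)⁻¹) * ENNReal.ofReal (g b) := by
    intro b hb
    have hb' : (0 : ℝ) < b := hb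
    rw [Real.Gamma_nat_eq_factorial, ← ENNReal.ofReal_mul (by positivity),
      ← ENNReal.ofReal_mul (by positivity), Real.one_rpow, add_sub_cancel_right, Real.rpow_natCast,
      one_mul]
    congr 1
    simp only [hg]
    ring
  rw [setLIntegral_congr_fun measurableSet_Ioi h2, lintegral_const_mul' _ _ ENNReal.ofReal_ne_top,
    ← ofReal_integral_eq_lintegral_ofReal hint, ← ENNReal.ofReal_mul (by positivity), hval]
  · congr 1; ring
  · refine (ae_restrict_mem measurableSet_Ioi).mono fun b hb => ?_
    have : (0 : ℝ) < b := hb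
    simp only [hg, Pi.zero_apply]
    positivity

/-- The Laplace transform of the SINR of an eavesdropper at a given position. -/
noncomputable def markLaplace (a₁ ϱ η : ℝ) (k : ℕ) (s : ℝ) (x : Plane) : ℝ≥0∞ :=
  ∫⁻ b, ∫⁻ a, ENNReal.ofReal (Real.exp (-(s * (a₁ * ‖x‖ ^ (-η) * a / (ϱ * b * ‖x‖ ^ (-η) + 1)))))
    ∂gammaMeasure 1 1 ∂gammaMeasure (k + 1) 1

instance isProbabilityMeasure_gammaMeasure_one : IsProbabilityMeasure (gammaMeasure 1 1) :=
  isProbabilityMeasure_gammaMeasure one_pos one_pos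

instance isProbabilityMeasure_gammaMeasure_succ (k : ℕ) :
    IsProbabilityMeasure (gammaMeasure (k + 1 : ℝ) 1) :=
  isProbabilityMeasure_gammaMeasure (by positivity) one_pos

lemma measurable_markLaplace (a₁ ϱ η : ℝ) (k : ℕ) (s : ℝ) :
    Measurable (markLaplace a₁ ϱ η k s) := by
  unfold markLaplace
  refine Measurable.lintegral_prod_right' (f := fun p : Plane × ℝ => ∫⁻ a, ENNReal.ofReal (Real.exp
    (-(s * (a₁ * ‖p.1‖ ^ (-η) * a / (ϱ * p.2 * ‖p.1‖ ^ (-η) + 1))))) ∂gammaMeasure 1 1) ?_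
  refine Measurable.lintegral_prod_right' (f := fun p : (Plane × ℝ) × ℝ => ENNReal.ofReal (Real.exp
    (-(s * (a₁ * ‖p.1.1‖ ^ (-η) * p.2 / (ϱ * p.1.2 * ‖p.1.1‖ ^ (-η) + 1)))))) ?_
  fun_prop

/-- The exponential average is `1/(1+θ)` with `θ = s a₁/(R + ϱ b)` and `R = ‖x‖^η`, and its
complement simplifies to one fraction. The origin is excluded so that `R > 0`; it is Lebesgue-null.
-/
lemma one_sub_markLaplace {a₁ ϱ η s : ℝ} (k : ℕ) (ha₁ : 0 < a₁) (hϱ : 0 < ϱ) (hs : 0 < s)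
    {x : Plane} (hx : x ≠ 0) :
    1 - markLaplace a₁ ϱ η k s x =
      ∫⁻ b, ENNReal.ofReal (s * a₁ / (‖x‖ ^ η + (ϱ * b + s * a₁))) ∂gammaMeasure (k + 1) 1 := by
  have hr : 0 < ‖x‖ := norm_pos_iff.mpr hx
  set R := ‖x‖ ^ η with hR
  have hR0 : 0 < R := Real.rpow_pos_of_pos hr _
  have hRn : ‖x‖ ^ (-η) = R⁻¹ := Real.rpow_neg hr.le _
  have h1 : markLaplace a₁ ϱ η k s x =
      ∫⁻ b, (1 - ENNReal.ofReal (s * a₁ / (R + (ϱ * b + s * a₁)))) ∂gammaMeasure (k + 1) 1 := by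
    refine lintegral_congr_ae ?_
    filter_upwards [ae_pos_gammaMeasure (k + 1) 1] with b hb
    rw [hRn]
    have : ∀ a : ℝ, -(s * (a₁ * R⁻¹ * a / (ϱ * b * R⁻¹ + 1))) = -((s * a₁ / (R + ϱ * b)) * a) := by
      intro a
      field_simp
      rw [add_comm]
    simp_rw [this]
    rw [lintegral_exp_neg_gammaMeasure_one (by positivity), ← ENNReal.ofReal_one,
      ← ENNReal.ofReal_sub _ (by positivity)]
    congr 1
    field_simp
    ring
  have hle : ∀ᵐ b ∂gammaMeasure (k + 1 : ℝ) 1,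
      ENNReal.ofReal (s * a₁ / (R + (ϱ * b + s * a₁))) ≤ 1 := by
    filter_upwards [ae_pos_gammaMeasure (k + 1) 1] with b hb
    rw [← ENNReal.ofReal_one]
    refine ENNReal.ofReal_le_ofReal ((div_le_one (by positivity)).mpr ?_)
    nlinarith [mul_pos hϱ hb]
  have hfin : ∫⁻ b, ENNReal.ofReal (s * a₁ / (R + (ϱ * b + s * a₁))) ∂gammaMeasure (k + 1 : ℝ) 1 ≤ 1 :=
    (lintegral_mono_ae hle).trans_eq (by simp)
  rw [h1, lintegral_sub (by fun_prop) (hfin.trans_lt ENNReal.one_lt_top).ne hle]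
  simp only [lintegral_const, measure_univ, mul_one]
  exact ENNReal.sub_sub_cancel ENNReal.one_ne_top hfin

/-- Tonelli, with the plane integrated first: for fixed `b` the integrand is the rational kernel
with constant `ϱ b + s a₁`. -/
lemma lintegral_one_sub_markLaplace {a₁ ϱ η s : ℝ} (k : ℕ) (ha₁ : 0 < a₁) (hϱ : 0 < ϱ)
    (hη : 2 < η) (hs : 0 < s) :
    ∫⁻ x : Plane, (1 - markLaplace a₁ ϱ η k s x) =
      ENNReal.ofReal (2 * Real.pi * (beta (2 / η) (1 - 2 / η) / η) * (s * a₁)) *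
        ∫⁻ b, ENNReal.ofReal ((ϱ * b + s * a₁) ^ (2 / η - 1)) ∂gammaMeasure (k + 1) 1 := by
  have hq : 0 < s * a₁ := mul_pos hs ha₁
  have hη0 : 0 < η := by linarith
  have hδ1 : 2 / η < 1 := (div_lt_one hη0).mpr hη
  have hbeta : 0 < beta (2 / η) (1 - 2 / η) := beta_pos (by positivity) (by linarith)
  have hae : ∀ᵐ x : Plane, x ≠ 0 := by
    rw [ae_iff]; simp
  have h1 : ∫⁻ x : Plane, (1 - markLaplace a₁ ϱ η k s x) = ∫⁻ x : Plane,
      ∫⁻ b, ENNReal.ofReal (s * a₁ / (‖x‖ ^ η + (ϱ * b + s * a₁))) ∂gammaMeasure (k + 1) 1 :=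
    lintegral_congr_ae (hae.mono fun x hx => one_sub_markLaplace k ha₁ hϱ hs hx)
  rw [h1, lintegral_lintegral_swap (by
    refine Measurable.aemeasurable ?_
    simp only [Function.uncurry_def]
    fun_prop), ← lintegral_const_mul' _ _ ENNReal.ofReal_ne_top]
  refine lintegral_congr_ae ?_
  filter_upwards [ae_pos_gammaMeasure (k + 1) 1] with b hb
  rw [lintegral_plane_div_rpow_add hη hq (by positivity), ← ENNReal.ofReal_mul (by positivity)]

/-- As `2/η - 1 < 0`, dropping `ϱ b` increases the power. The bound vanishes as `s → 0`, which is
what finiteness of the sum requires. -/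
lemma lintegral_one_sub_markLaplace_le {a₁ ϱ η s : ℝ} (k : ℕ) (ha₁ : 0 < a₁) (hϱ : 0 < ϱ)
    (hη : 2 < η) (hs : 0 < s) :
    ∫⁻ x : Plane, (1 - markLaplace a₁ ϱ η k s x) ≤
      ENNReal.ofReal (2 * Real.pi * (beta (2 / η) (1 - 2 / η) / η) * (s * a₁) ^ (2 / η)) := by
  have hq : 0 < s * a₁ := mul_pos hs ha₁
  have hη0 : 0 < η := by linarith
  have hδ1 : 2 / η < 1 := (div_lt_one hη0).mpr hη
  have hbeta : 0 < beta (2 / η) (1 - 2 / η) := beta_pos (by positivity) (by linarith)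
  have hle : ∫⁻ b, ENNReal.ofReal ((ϱ * b + s * a₁) ^ (2 / η - 1)) ∂gammaMeasure (k + 1 : ℝ) 1 ≤
      ENNReal.ofReal ((s * a₁) ^ (2 / η - 1)) := by
    refine (lintegral_mono_ae (g := fun _ => ENNReal.ofReal ((s * a₁) ^ (2 / η - 1))) ?_).trans_eq
      (by simp)
    filter_upwards [ae_pos_gammaMeasure (k + 1) 1] with b hb
    refine ENNReal.ofReal_le_ofReal (Real.rpow_le_rpow_of_nonpos hq ?_ (by linarith))
    nlinarith [mul_pos hϱ hb]
  rw [lintegral_one_sub_markLaplace k ha₁ hϱ hη hs]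
  refine (mul_le_mul_right hle _).trans_eq ?_
  rw [← ENNReal.ofReal_mul (by positivity), mul_assoc _ (s * a₁), mul_comm (s * a₁),
    ← Real.rpow_add_one hq.ne', sub_add_cancel]

lemma lintegral_one_sub_markLaplace_eq_whittakerW {a₁ ϱ η s : ℝ} (k : ℕ) (ha₁ : 0 < a₁)
    (hϱ : 0 < ϱ) (hη : 2 < η) (hs : 0 < s) {C : ℝ} (hC : C = 2 * Real.pi *
      (beta (2 / η) (1 - 2 / η) / η * ϱ ^ ((1 - ((k + 2 : ℕ) : ℝ) + 2 / η) / 2)) *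
      Real.exp (a₁ / ϱ * s / 2) * (a₁ * s) ^ ((((k + 2 : ℕ) : ℝ) - 1 + 2 / η) / 2) *
      whittakerW ((1 - ((k + 2 : ℕ) : ℝ) + 2 / η) / 2) ((2 - ((k + 2 : ℕ) : ℝ) - 2 / η) / 2)
        (a₁ / ϱ * s)) :
    0 ≤ C ∧ ∫⁻ x : Plane, (1 - markLaplace a₁ ϱ η k s x) = ENNReal.ofReal C := by
  have hq : 0 < s * a₁ := mul_pos hs ha₁
  have hη0 : 0 < η := by linarith
  have hδ0 : 0 < 2 / η := by positivity
  have hδ1 : 2 / η < 1 := (div_lt_one hη0).mpr hη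
  have hbeta : 0 < beta (2 / η) (1 - 2 / η) := beta_pos (by positivity) (by linarith)
  rw [lintegral_one_sub_markLaplace k ha₁ hϱ hη hs, lintegral_rpow_gammaMeasure k (2 / η) hϱ hq,
    ← ENNReal.ofReal_mul (by positivity)]
  rw [whittakerW_eq_integral k hδ0 hδ1 (by positivity)] at hC
  have hz : a₁ / ϱ * s = s * a₁ / ϱ := by ring
  rw [hz] at hC
  set δ := 2 / η with hδ
  set q := s * a₁ with hqdef
  set z := q / ϱ with hzdef
  have hz0 : 0 < z := by positivity
  set I := ∫ t in Set.Ioi (0 : ℝ), t ^ k * (1 + t) ^ (δ - 1) * Real.exp (-(z * t))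
  have hI : 0 ≤ I := setIntegral_nonneg measurableSet_Ioi fun t ht => by
    have : (0 : ℝ) < t := ht
    positivity
  have hexp : Real.exp (-z / 2) * Real.exp (z / 2) = 1 := by
    rw [← Real.exp_add, ← Real.exp_zero]; congr 1; ring
  -- The half-integral shifts in the closed form recombine here: the power of `ϱ` in the constant,
  -- the power of `a₁ s` and the power of `z` from the Whittaker function give the powers left by
  -- the substitution.
  have hpow : ϱ ^ ((1 - ((k + 2 : ℕ) : ℝ) + δ) / 2) * (a₁ * s) ^ ((((k + 2 : ℕ) : ℝ) - 1 + δ) / 2) *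
      z ^ (((k : ℝ) + 1 + δ) / 2) = q * (z ^ (k + 1) * q ^ (δ - 1)) := by
    push_cast
    rw [mul_comm a₁ s, ← hqdef, hzdef, Real.div_rpow hq.le hϱ.le, div_pow,
      ← Real.rpow_natCast, ← Real.rpow_natCast ϱ, div_eq_mul_inv (q ^ _), div_eq_mul_inv (q ^ ((k + 1 : ℕ) : ℝ)),
      ← Real.rpow_neg hϱ.le, ← Real.rpow_neg hϱ.le]
    calc ϱ ^ ((1 - ((k : ℝ) + 2) + δ) / 2) * q ^ (((k : ℝ) + 2 - 1 + δ) / 2) *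
          (q ^ (((k : ℝ) + 1 + δ) / 2) * ϱ ^ (-(((k : ℝ) + 1 + δ) / 2)))
        = (ϱ ^ ((1 - ((k : ℝ) + 2) + δ) / 2) * ϱ ^ (-(((k : ℝ) + 1 + δ) / 2))) *
          (q ^ (((k : ℝ) + 2 - 1 + δ) / 2) * q ^ (((k : ℝ) + 1 + δ) / 2)) := by ring
      _ = ϱ ^ (-((k + 1 : ℕ) : ℝ)) * q ^ ((k : ℝ) + 1 + δ) := by
          rw [← Real.rpow_add hϱ, ← Real.rpow_add hq]
          push_cast
          congr 2 <;> ring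
      _ = q * (q ^ ((k + 1 : ℕ) : ℝ) * ϱ ^ (-((k + 1 : ℕ) : ℝ)) * q ^ (δ - 1)) := by
          have : q ^ ((k : ℝ) + 1 + δ) = q * q ^ ((k + 1 : ℕ) : ℝ) * q ^ (δ - 1) := by
            rw [mul_comm q, ← Real.rpow_add_one hq.ne', ← Real.rpow_add hq]
            push_cast
            congr 1; ring
          rw [this]; ring
  suffices hval : 2 * Real.pi * (beta δ (1 - δ) / η) * q *
      ((k.factorial : ℝ)⁻¹ * z ^ (k + 1) * q ^ (δ - 1) * I) = C from
    ⟨hval ▸ by positivity, congrArg ENNReal.ofReal hval⟩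
  calc 2 * Real.pi * (beta δ (1 - δ) / η) * q * ((k.factorial : ℝ)⁻¹ * z ^ (k + 1) * q ^ (δ - 1) * I)
      = 2 * Real.pi * (beta δ (1 - δ) / η) * ((k.factorial : ℝ)⁻¹ * I) *
          (q * (z ^ (k + 1) * q ^ (δ - 1))) := by ring
    _ = 2 * Real.pi * (beta δ (1 - δ) / η) * ((k.factorial : ℝ)⁻¹ * I) *
          (q * (z ^ (k + 1) * q ^ (δ - 1))) * (Real.exp (-z / 2) * Real.exp (z / 2)) := by
        rw [hexp, mul_one]
    _ = _ := by
        rw [hC, ← hpow]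
        ring

lemma ae_nonneg_markExponent {a₁ ϱ η s : ℝ} (k : ℕ) (ha₁ : 0 < a₁) (hϱ : 0 < ϱ) (hs : 0 < s)
    (x : Plane) : ∀ᵐ b ∂gammaMeasure (k + 1 : ℝ) 1, ∀ᵐ a ∂gammaMeasure 1 1,
      0 ≤ s * (a₁ * ‖x‖ ^ (-η) * a / (ϱ * b * ‖x‖ ^ (-η) + 1)) := by
  filter_upwards [ae_pos_gammaMeasure (k + 1) 1] with b hb
  filter_upwards [ae_pos_gammaMeasure 1 1] with a ha
  have := Real.rpow_nonneg (norm_nonneg x) (-η)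
  positivity

lemma markLaplace_le_one {a₁ ϱ η s : ℝ} (k : ℕ) (ha₁ : 0 < a₁) (hϱ : 0 < ϱ) (hs : 0 < s)
    (x : Plane) : markLaplace a₁ ϱ η k s x ≤ 1 := by
  have h : markLaplace a₁ ϱ η k s x ≤ ∫⁻ _, ∫⁻ _, 1 ∂gammaMeasure 1 1 ∂gammaMeasure (k + 1 : ℝ) 1 := by
    refine lintegral_mono_ae ((ae_nonneg_markExponent (η := η) k ha₁ hϱ hs x).mono
      fun b hb => ?_)
    refine lintegral_mono_ae (hb.mono fun a ha => ?_)
    rw [← ENNReal.ofReal_one]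
    exact ENNReal.ofReal_le_ofReal (Real.exp_le_one_iff.mpr (by linarith))
  simpa using h

/-! ### The exponential on `[0,∞]`, for Laplace transforms of sums not yet known to converge. -/

/-- The function `x ↦ e^{-x}` on `[0, ∞]`. -/
noncomputable def expNeg (x : ℝ≥0∞) : ℝ≥0∞ := (EReal.exp (x : EReal))⁻¹

lemma continuous_expNeg : Continuous expNeg :=
  continuous_inv.comp (ENNReal.continuous_exp.comp continuous_coe_ennreal_ereal)

@[fun_prop]
lemma measurable_expNeg : Measurable expNeg := continuous_expNeg.measurable

lemma expNeg_ofReal {r : ℝ} (hr : 0 ≤ r) : expNeg (ENNReal.ofReal r) = ENNReal.ofReal (Real.exp (-r)) := by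
  rw [expNeg, EReal.coe_ennreal_ofReal, max_eq_left hr, EReal.exp_coe,
    ← ENNReal.ofReal_inv_of_pos (Real.exp_pos _), Real.exp_neg]

@[simp]
lemma expNeg_zero : expNeg 0 = 1 := by simp [expNeg]

@[simp]
lemma expNeg_top : expNeg ∞ = 0 := by simp [expNeg]

lemma expNeg_antitone : Antitone expNeg := fun _ _ h =>
  ENNReal.inv_le_inv.mpr (EReal.exp_monotone (EReal.coe_ennreal_le_coe_ennreal_iff.mpr h))

lemma expNeg_le_one (x : ℝ≥0∞) : expNeg x ≤ 1 := expNeg_zero ▸ expNeg_antitone (zero_le (a := x))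

lemma expNeg_add (x y : ℝ≥0∞) : expNeg (x + y) = expNeg x * expNeg y := by
  have h : ∀ z : ℝ≥0∞, EReal.exp (z : EReal) ≠ 0 := fun z => by simp
  rw [expNeg, expNeg, expNeg, EReal.coe_ennreal_add, EReal.exp_add,
    ENNReal.mul_inv (Or.inl (h x)) (Or.inr (h y))]

lemma expNeg_sum {ι : Type*} (s : Finset ι) (f : ι → ℝ≥0∞) :
    expNeg (∑ i ∈ s, f i) = ∏ i ∈ s, expNeg (f i) := by
  classical
  induction s using Finset.induction_on with
  | empty => simp
  | insert a s ha ih => rw [Finset.sum_insert ha, Finset.prod_insert ha, expNeg_add, ih]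

lemma expNeg_eq_ofReal {x : ℝ≥0∞} (hx : x ≠ ∞) : expNeg x = ENNReal.ofReal (Real.exp (-x.toReal)) := by
  rw [← expNeg_ofReal ENNReal.toReal_nonneg, ENNReal.ofReal_toReal hx]

lemma lintegral_expNeg_poissonMeasure (r : ℝ≥0) {y : ℝ≥0∞} (hy : y ≠ ∞) :
    ∫⁻ n : ℕ, expNeg (n * y) ∂poissonMeasure r = expNeg (r * (1 - expNeg y)) := by
  set c := y.toReal with hc
  have hc0 : 0 ≤ c := ENNReal.toReal_nonneg
  have hyc : y = ENNReal.ofReal c := (ENNReal.ofReal_toReal hy).symm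
  rw [lintegral_countable']
  have h1 : ∀ n : ℕ, expNeg (n * y) * poissonMeasure r {n} =
      ENNReal.ofReal (Real.exp (-r) * ((r * Real.exp (-c)) ^ n / n.factorial)) := by
    intro n
    rw [poissonMeasure_singleton, hyc, ← ENNReal.ofReal_natCast n,
      ← ENNReal.ofReal_mul (by positivity), expNeg_ofReal (by positivity),
      ← ENNReal.ofReal_mul (by positivity), mul_pow, ← Real.exp_nat_mul]
    congr 1
    rw [mul_neg]
    ring
  have hs : HasSum (fun n : ℕ => Real.exp (-r) * ((r * Real.exp (-c)) ^ n / n.factorial))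
      (Real.exp (-r) * Real.exp (r * Real.exp (-c))) := by
    have h := NormedSpace.expSeries_div_hasSum_exp ((r : ℝ) * Real.exp (-c))
    rw [← Real.exp_eq_exp_ℝ] at h
    exact h.mul_left _
  have hr : 0 ≤ (r : ℝ) * (1 - Real.exp (-c)) :=
    mul_nonneg r.coe_nonneg (sub_nonneg.mpr (Real.exp_le_one_iff.mpr (by linarith)))
  have hR : (r : ℝ≥0∞) * (1 - expNeg y) = ENNReal.ofReal (r * (1 - Real.exp (-c))) := by
    rw [ENNReal.ofReal_mul r.coe_nonneg, ENNReal.ofReal_coe_nnreal,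
      ENNReal.ofReal_sub _ (Real.exp_pos _).le, ENNReal.ofReal_one, hyc, expNeg_ofReal hc0]
  rw [tsum_congr h1, ← ENNReal.ofReal_tsum_of_nonneg (fun n => by positivity) hs.summable,
    hs.tsum_eq, ← Real.exp_add, hR, expNeg_ofReal hr]
  congr 2; ring

/-! ### The Laplace functional of a Poisson process. -/

section PoissonPointProcess

variable {Ω E : Type*} [MeasurableSpace Ω] [MeasurableSpace E] {X : ℕ → Ω → E} {Λ : Measure E}
  {P : Measure Ω}

lemma tsum_indicator_const_eq_pointCount (X : ℕ → Ω → E) (A : Set E) (y : ℝ≥0∞) (ω : Ω) :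
    ∑' i, A.indicator (fun _ => y) (X i ω) = pointCount X A ω * y := by
  rw [pointCount, ← ENNReal.tsum_set_const, tsum_subtype {i | X i ω ∈ A} fun _ => y]
  rfl

lemma measurable_pointCount (hX : ∀ i, Measurable (X i)) {A : Set E} (hA : MeasurableSet A) :
    Measurable fun ω => (pointCount X A ω : ℝ≥0∞) := by
  have h : (fun ω => (pointCount X A ω : ℝ≥0∞)) =
      fun ω => ∑' i, A.indicator (fun _ => (1 : ℝ≥0∞)) (X i ω) := by
    ext ω
    rw [tsum_indicator_const_eq_pointCount, mul_one]
  rw [h]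
  exact Measurable.tsum fun i => (measurable_const.indicator hA).comp (hX i)

lemma lintegral_expNeg_pointCount (hX : IsPoissonPointProcess X Λ P) {A : Set E}
    (hA : MeasurableSet A) (hΛ : Λ A ≠ ∞) {y : ℝ≥0∞} (hy : y ≠ ∞) :
    ∫⁻ ω, expNeg (pointCount X A ω * y) ∂P = expNeg (Λ A * (1 - expNeg y)) := by
  have h := hX.hasLaw_count A hA hΛ
  have h1 : ∫⁻ ω, expNeg (pointCount X A ω * y) ∂P =
      ∫⁻ n : ℕ∞, expNeg ((n : ℝ≥0∞) * y) ∂(P.map (pointCount X A)) :=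
    (lintegral_map' (f := fun n : ℕ∞ => expNeg ((n : ℝ≥0∞) * y))
      (Measurable.of_discrete).aemeasurable h.aemeasurable).symm
  rw [h1, h.map_eq, lintegral_map Measurable.of_discrete Measurable.of_discrete]
  simp only [ENat.toENNReal_coe]
  rw [lintegral_expNeg_poissonMeasure _ hy, ENNReal.coe_toNNReal hΛ]

/-- On the level sets within `B` the sum is a finite combination of point counts. These sets are
disjoint, so the counts are independent and the transform factorizes into Poisson transforms. The
set `B` supplies the finite intensity needed for the counts to be Poisson. -/
lemma lintegral_expNeg_tsum_simpleFunc [IsProbabilityMeasure P] (hX : IsPoissonPointProcess X Λ P)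
    (f : SimpleFunc E ℝ≥0∞) (hf : ∀ x, f x ≠ ∞) {B : Set E} (hB : MeasurableSet B) (hΛ : Λ B ≠ ∞) :
    ∫⁻ ω, expNeg (∑' i, B.indicator f (X i ω)) ∂P =
      expNeg (∫⁻ x, (1 - expNeg (B.indicator f x)) ∂Λ) := by
  classical
  let e := f.range.equivFin.symm
  let y : Fin f.range.card → ℝ≥0∞ := fun j => (e j : ℝ≥0∞)
  let A : Fin f.range.card → Set E := fun j => f ⁻¹' {y j} ∩ B
  have hA : ∀ j, MeasurableSet (A j) := fun j => (f.measurableSet_fiber _).inter hB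
  have hyfin : ∀ j, y j ≠ ∞ := fun j => by
    obtain ⟨x, hx⟩ := SimpleFunc.mem_range.mp (e j).2
    change (e j : ℝ≥0∞) ≠ ∞
    rw [← hx]
    exact hf x
  have hdisj : Pairwise fun j l => Disjoint (A j) (A l) := by
    intro j l hjl
    refine Set.disjoint_left.mpr fun x hx hx' => hjl ?_
    have : y j = y l := hx.1.symm.trans hx'.1
    exact e.injective (Subtype.ext this)
  have hΛA : ∀ j, Λ (A j) ≠ ∞ := fun j =>
    ne_top_of_le_ne_top hΛ (measure_mono Set.inter_subset_right)
  have hdecomp : ∀ (φ : ℝ≥0∞ → ℝ≥0∞) (x : E),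
      B.indicator (fun x => φ (f x)) x = ∑ j, (A j).indicator (fun _ => φ (y j)) x := by
    intro φ x
    by_cases hx : x ∈ B
    · obtain ⟨j, hj⟩ := e.surjective ⟨f x, SimpleFunc.mem_range_self f x⟩
      have hyj : y j = f x := congrArg Subtype.val hj
      rw [Set.indicator_of_mem hx, Finset.sum_eq_single j, Set.indicator_of_mem, hyj]
      · exact ⟨hyj.symm, hx⟩
      · intro l _ hl
        refine Set.indicator_of_notMem (fun hxl => hl ?_) _
        have : y l = y j := hxl.1.symm.trans hyj.symm
        exact e.injective (Subtype.ext this)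
      · simp
    · rw [Set.indicator_of_notMem hx]
      exact (Finset.sum_eq_zero fun j _ => Set.indicator_of_notMem (fun h => hx h.2) _).symm
  have hsum : ∀ ω, ∑' i, B.indicator f (X i ω) = ∑ j, (pointCount X (A j) ω : ℝ≥0∞) * y j := by
    intro ω
    have : ∀ i, B.indicator f (X i ω) = ∑ j, (A j).indicator (fun _ => y j) (X i ω) := fun i =>
      hdecomp id (X i ω)
    simp_rw [this, ← tsum_indicator_const_eq_pointCount]
    rw [Summable.tsum_finsetSum fun _ _ => ENNReal.summable]
  have hind : iIndepFun (fun j ω => expNeg ((pointCount X (A j) ω : ℝ≥0∞) * y j)) P :=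
    (hX.indep_count _ A hA hdisj).comp (fun j (n : ℕ∞) => expNeg ((n : ℝ≥0∞) * y j))
      fun j => Measurable.of_discrete
  have hmeas : ∀ j, Measurable fun ω => expNeg ((pointCount X (A j) ω : ℝ≥0∞) * y j) := fun j =>
    measurable_expNeg.comp ((measurable_pointCount hX.measurable (hA j)).mul_const _)
  simp_rw [hsum, expNeg_sum]
  rw [lintegral_prod_eq_prod_lintegral_of_indepFun _ _ hind hmeas]
  simp_rw [fun j => lintegral_expNeg_pointCount hX (hA j) (hΛA j) (hyfin j)]
  rw [← expNeg_sum]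
  congr 1
  have hint : ∀ x, 1 - expNeg (B.indicator f x) =
      ∑ j, (A j).indicator (fun _ => 1 - expNeg (y j)) x := by
    intro x
    rw [← hdecomp (fun z => 1 - expNeg z) x]
    by_cases hx : x ∈ B <;> simp [hx]
  simp_rw [hint]
  rw [lintegral_finsetSum _ fun j _ => measurable_const.indicator (hA j)]
  refine Finset.sum_congr rfl fun j _ => ?_
  rw [lintegral_indicator_const (hA j), mul_comm]

/-- The Laplace functional of a Poisson point process. -/
theorem lintegral_expNeg_tsum [IsProbabilityMeasure P] [SigmaFinite Λ]
    (hX : IsPoissonPointProcess X Λ P) {f : E → ℝ≥0∞} (hf : Measurable f) :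
    ∫⁻ ω, expNeg (∑' i, f (X i ω)) ∂P = expNeg (∫⁻ x, (1 - expNeg (f x)) ∂Λ) := by
  let B := spanningSets Λ
  -- Simple approximation and restriction to sets of finite intensity are done together, increasing
  -- to `f`. The left side then converges by domination by 1, the exponent by monotone convergence.
  let F : ℕ → E → ℝ≥0∞ := fun m => (B m).indicator (SimpleFunc.eapprox f m)
  have hFm : ∀ m, Measurable (F m) := fun m =>
    (SimpleFunc.measurable _).indicator (measurableSet_spanningSets Λ m)
  have hmono : ∀ x, Monotone fun m => F m x := by
    intro x m l hml
    refine (Set.indicator_le_indicator (SimpleFunc.monotone_eapprox f hml x)).trans ?_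
    exact Set.indicator_le_indicator_of_subset (monotone_spanningSets Λ hml) (fun _ => zero_le) x
  have hlim : ∀ x, Tendsto (fun m => F m x) atTop (𝓝 (f x)) := by
    intro x
    refine (SimpleFunc.tendsto_eapprox hf x).congr' ?_
    filter_upwards [eventually_ge_atTop (spanningSetsIndex Λ x)] with m hm
    exact (Set.indicator_of_mem (mem_spanningSets_of_index_le Λ x hm) _).symm
  have heq : ∀ m, ∫⁻ ω, expNeg (∑' i, F m (X i ω)) ∂P = expNeg (∫⁻ x, (1 - expNeg (F m x)) ∂Λ) :=
    fun m => lintegral_expNeg_tsum_simpleFunc hX _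
      (fun x => (SimpleFunc.eapprox_lt_top f m x).ne) (measurableSet_spanningSets Λ m)
      (measure_spanningSets_lt_top Λ m).ne
  have hsum : ∀ ω, Tendsto (fun m => ∑' i, F m (X i ω)) atTop (𝓝 (∑' i, f (X i ω))) := by
    intro ω
    simp_rw [← lintegral_count]
    exact lintegral_tendsto_of_tendsto_of_monotone (fun m => Measurable.of_discrete.aemeasurable)
      (.of_forall fun i => hmono (X i ω)) (.of_forall fun i => hlim (X i ω))
  have h1 : Tendsto (fun m => ∫⁻ ω, expNeg (∑' i, F m (X i ω)) ∂P) atTop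
      (𝓝 (∫⁻ ω, expNeg (∑' i, f (X i ω)) ∂P)) := by
    refine tendsto_lintegral_of_dominated_convergence (fun _ => 1) (fun m => ?_)
      (fun m => .of_forall fun ω => expNeg_le_one _) (by simp)
      (.of_forall fun ω => (continuous_expNeg.tendsto _).comp (hsum ω))
    exact measurable_expNeg.comp (Measurable.tsum fun i => (hFm m).comp (hX.measurable i))
  have h2 : Tendsto (fun m => ∫⁻ x, (1 - expNeg (F m x)) ∂Λ) atTop
      (𝓝 (∫⁻ x, (1 - expNeg (f x)) ∂Λ)) := by
    refine lintegral_tendsto_of_tendsto_of_monotone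
      (fun m => (measurable_const.sub (measurable_expNeg.comp (hFm m))).aemeasurable)
      (.of_forall fun x m l hml => tsub_le_tsub_left (expNeg_antitone (hmono x hml)) 1)
      (.of_forall fun x => ?_)
    exact ENNReal.Tendsto.sub tendsto_const_nhds
      ((continuous_expNeg.tendsto _).comp (hlim x)) (Or.inl ENNReal.one_ne_top)
  simp_rw [heq] at h1
  exact tendsto_nhds_unique h1 ((continuous_expNeg.tendsto _).comp h2)

/-- The count is Poisson with parameter 0. Applied to the origin, where the path loss is degenerate.
-/
lemma ae_forall_notMem_of_measure_zero (hX : IsPoissonPointProcess X Λ P) {A : Set E}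
    (hA : MeasurableSet A) (hΛ : Λ A = 0) : ∀ᵐ ω ∂P, ∀ i, X i ω ∉ A := by
  have h := hX.hasLaw_count A hA (by simp [hΛ])
  have h0 : ∀ᵐ n ∂((poissonMeasure (Λ A).toNNReal).map (Nat.cast : ℕ → ℕ∞)), n = 0 := by
    rw [ae_map_iff (Measurable.of_discrete).aemeasurable (MeasurableSet.of_discrete), hΛ, ae_iff]
    rw [← lintegral_indicator_one MeasurableSet.of_discrete, lintegral_countable']
    refine ENNReal.tsum_eq_zero.mpr fun n => ?_
    rcases n with _ | n <;> simp [poissonMeasure_singleton]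
  rw [← h.map_eq] at h0
  filter_upwards [ae_of_ae_map h.aemeasurable h0] with ω hω i hi
  have : {i : ℕ | X i ω ∈ A} = ∅ := Set.encard_eq_zero.mp hω
  exact (this ▸ (show i ∈ {i : ℕ | X i ω ∈ A} from hi) : i ∈ (∅ : Set ℕ))

end PoissonPointProcess

/-! ### Smoothing a tail by a Gamma threshold. -/

section Smoothing

variable {Ω : Type*} [MeasurableSpace Ω] {P : Measure Ω} [IsProbabilityMeasure P] {Y : Ω → ℝ}

lemma measurable_normalizedGamma_Iio (k : ℕ) :
    Measurable fun x : ℝ => (normalizedGamma (k + 1)).real (Set.Iio x) := by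
  refine Monotone.measurable fun x y hxy => ?_
  exact measureReal_mono (Set.Iio_subset_Iio hxy)

lemma gammaSmoothedCcdf_succ_eq_integral (hY : Measurable Y) (k : ℕ) (t : ℝ) :
    gammaSmoothedCcdf P Y (k + 1) t =
      ∫ ω, (normalizedGamma (k + 1)).real (Set.Iio (Y ω / t)) ∂P := by
  have hs : MeasurableSet {p : Ω × ℝ | p.2 < Y p.1 / t} :=
    measurableSet_lt measurable_snd ((hY.comp measurable_fst).div_const t)
  have hm : Measurable fun ω => normalizedGamma (k + 1) (Prod.mk ω ⁻¹' {p : Ω × ℝ | p.2 < Y p.1 / t}) :=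
    measurable_measure_prodMk_left hs
  rw [gammaSmoothedCcdf, measureReal_def, Measure.prod_apply hs,
    ← integral_toReal hm.aemeasurable (.of_forall fun ω => measure_lt_top _ _)]
  rfl

lemma integrable_normalizedGamma_Iio (hY : Measurable Y) (k : ℕ) (t : ℝ) :
    Integrable (fun ω => (normalizedGamma (k + 1)).real (Set.Iio (Y ω / t))) P := by
  refine Integrable.of_bound
    ((measurable_normalizedGamma_Iio k).comp (hY.div_const t)).aestronglyMeasurable 1
    (.of_forall fun ω => ?_)
  rw [Real.norm_of_nonneg measureReal_nonneg]
  exact measureReal_le_one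

/-- The Gamma distribution function at `Y/t` tends to 0 or 1 according to the side of 1 on which
`Y/t` lies. Nothing is claimed at `Y = t`, so that event must be null. -/
lemma tendsto_gammaSmoothedCcdf (hY : Measurable Y) {t : ℝ} (ht : 0 < t)
    (hatom : ∀ᵐ ω ∂P, Y ω ≠ t) :
    Tendsto (fun K : ℕ => gammaSmoothedCcdf P Y K t) atTop (𝓝 (ccdf P Y t)) := by
  -- Shape 0 gives no probability law, so the sequence is started at shape 1.
  rw [← tendsto_add_atTop_iff_nat 1]
  have hs : MeasurableSet {ω | t < Y ω} := measurableSet_lt measurable_const hY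
  have hlim : ccdf P Y t = ∫ ω, {ω | t < Y ω}.indicator (fun _ => (1 : ℝ)) ω ∂P := by
    rw [integral_indicator_const _ hs, smul_eq_mul, mul_one, ccdf]
  rw [hlim]
  simp_rw [gammaSmoothedCcdf_succ_eq_integral hY]
  refine tendsto_integral_of_dominated_convergence (fun _ => 1)
    (fun k => (integrable_normalizedGamma_Iio hY k t).aestronglyMeasurable) (integrable_const _)
    (fun k => .of_forall fun ω => ?_) ?_
  · rw [Real.norm_of_nonneg measureReal_nonneg]
    exact measureReal_le_one
  · filter_upwards [hatom] with ω hω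
    rcases lt_or_gt_of_ne hω with h | h
    · rw [Set.indicator_of_notMem (show ω ∉ {ω | t < Y ω} from not_lt.mpr h.le)]
      exact tendsto_normalizedGamma_Iio_of_lt ((div_lt_one ht).mpr h)
    · rw [Set.indicator_of_mem (show ω ∈ {ω | t < Y ω} from h)]
      exact tendsto_normalizedGamma_Iio_of_gt ((one_lt_div ht).mpr h)

lemma alzer_nonneg (K : ℕ) : 0 ≤ alzer K := by unfold alzer; positivity

lemma integrable_exp_neg_mul (hY : Measurable Y) (hY0 : ∀ ω, 0 ≤ Y ω) {s : ℝ} (hs : 0 ≤ s) :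
    Integrable (fun ω => Real.exp (-s * Y ω)) P := by
  refine Integrable.of_bound (hY.const_mul _).exp.aestronglyMeasurable 1 (.of_forall fun ω => ?_)
  rw [Real.norm_of_nonneg (Real.exp_pos _).le]
  exact Real.exp_le_one_iff.mpr (by nlinarith [hY0 ω, mul_nonneg hs (hY0 ω)])

lemma laplaceCcdfApprox_eq_integral (hY : Measurable Y) (hY0 : ∀ ω, 0 ≤ Y ω) {t : ℝ} (ht : 0 < t)
    (K : ℕ) :
    laplaceCcdfApprox P Y K t = ∫ ω, (1 - Real.exp (-alzer K * (Y ω / t))) ^ K ∂P := by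
  have h : ∀ ω, (1 - Real.exp (-alzer K * (Y ω / t))) ^ K = ∑ k ∈ Finset.range (K + 1),
      (K.choose k : ℝ) * (-1) ^ k * Real.exp (-(k * alzer K / t) * Y ω) := by
    intro ω
    rw [sub_eq_neg_add, add_pow]
    refine Finset.sum_congr rfl fun k _ => ?_
    rw [one_pow, mul_one, neg_pow, ← Real.exp_nat_mul,
      show (k : ℝ) * (-alzer K * (Y ω / t)) = -(k * alzer K / t) * Y ω by ring]
    ring
  simp_rw [h]
  rw [integral_finsetSum]
  · simp_rw [integral_const_mul]
    rfl
  · intro k _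
    refine (integrable_exp_neg_mul hY hY0 ?_).const_mul _
    have := alzer_nonneg K
    positivity

lemma laplaceCcdfApprox_le_gammaSmoothedCcdf (hY : Measurable Y) (hY0 : ∀ ω, 0 ≤ Y ω) {t : ℝ}
    (ht : 0 < t) {K : ℕ} (hK : 1 ≤ K) :
    laplaceCcdfApprox P Y K t ≤ gammaSmoothedCcdf P Y K t := by
  rw [laplaceCcdfApprox_eq_integral hY hY0 ht]
  obtain ⟨k, rfl⟩ := Nat.exists_eq_add_of_le' hK
  rw [gammaSmoothedCcdf_succ_eq_integral hY]
  have hbd : ∀ ω, 0 ≤ 1 - Real.exp (-alzer (k + 1) * (Y ω / t)) := fun ω => by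
    have := mul_nonneg (alzer_nonneg (k + 1)) (div_nonneg (hY0 ω) ht.le)
    exact sub_nonneg.mpr (Real.exp_le_one_iff.mpr (by linarith))
  refine integral_mono_of_nonneg (.of_forall fun ω => pow_nonneg (hbd ω) _)
    (integrable_normalizedGamma_Iio hY k t) (.of_forall fun ω => ?_)
  exact one_sub_exp_pow_le_normalizedGamma hK (div_nonneg (hY0 ω) ht.le)

end Smoothing

/-! ### Independent marks: Laplace functional and absence of atoms. -/

lemma exists_measurable_expNeg_eq {E : Type*} [MeasurableSpace E] {φ : E → ℝ≥0∞}
    (hφ : Measurable φ) (h1 : ∀ x, φ x ≤ 1) :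
    ∃ f : E → ℝ≥0∞, Measurable f ∧ ∀ x, expNeg (f x) = φ x := by
  refine ⟨fun x => (ENNReal.log (φ x)⁻¹).toENNReal,
    (ENNReal.measurable_log.comp hφ.inv).ereal_toENNReal, fun x => ?_⟩
  have h0 : 0 ≤ ENNReal.log (φ x)⁻¹ := by
    rw [← ENNReal.log_one]
    exact ENNReal.log_monotone (ENNReal.one_le_inv.mpr (h1 x))
  rw [expNeg, EReal.coe_toENNReal h0, ENNReal.exp_log, inv_inv]

section Marks

variable {Ω E M 𝓩 : Type*} [MeasurableSpace Ω] [MeasurableSpace E] [MeasurableSpace M]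
  [MeasurableSpace 𝓩] {P : Measure Ω} [IsProbabilityMeasure P] {Z : Ω → 𝓩} {H : ℕ → Ω → M}
  {μ : Measure M} {u : ℕ → 𝓩 → M → ℝ≥0∞}

lemma lintegral_comp_env_marks (hZ : Measurable Z) (hH : ∀ i, Measurable (H i))
    (hHZ : IndepFun (fun ω i => H i ω) Z P) {F : 𝓩 → (ℕ → M) → ℝ≥0∞}
    (hF : Measurable (Function.uncurry F)) :
    ∫⁻ ω, F (Z ω) (fun i => H i ω) ∂P = ∫⁻ z, ∫⁻ ω, F z (fun i => H i ω) ∂P ∂(P.map Z) := by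
  have hHm : Measurable fun ω i => H i ω := measurable_pi_lambda _ hH
  have hjoint := (indepFun_iff_map_prod_eq_prod_map_map hZ.aemeasurable hHm.aemeasurable).mp hHZ.symm
  have hpZ : IsProbabilityMeasure (P.map Z) := Measure.isProbabilityMeasure_map hZ.aemeasurable
  have hpH : IsProbabilityMeasure (P.map fun ω i => H i ω) :=
    Measure.isProbabilityMeasure_map hHm.aemeasurable
  calc ∫⁻ ω, F (Z ω) (fun i => H i ω) ∂P
      = ∫⁻ p, Function.uncurry F p ∂(P.map fun ω => (Z ω, fun i => H i ω)) :=
        (lintegral_map hF (hZ.prodMk hHm)).symm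
    _ = ∫⁻ z, ∫⁻ m, F z m ∂(P.map fun ω i => H i ω) ∂(P.map Z) := by
        rw [hjoint, lintegral_prod _ hF.aemeasurable]
        rfl
    _ = _ := lintegral_congr fun z => lintegral_map (hF.comp measurable_prodMk_left) hHm

/-- Given the environment the marks remain independent, so each factor can be replaced by its mark
average. Finitely many factors are used here; the infinite sum is a limit taken later. -/
lemma lintegral_prod_expNeg_marks (hZ : Measurable Z) (hH : ∀ i, Measurable (H i))
    (hlaw : ∀ i, P.map (H i) = μ) (hind : iIndepFun H P) (hHZ : IndepFun (fun ω i => H i ω) Z P)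
    (hu : ∀ i, Measurable (Function.uncurry (u i))) (N : ℕ) :
    ∫⁻ ω, expNeg (∑ i ∈ Finset.range N, u i (Z ω) (H i ω)) ∂P =
      ∫⁻ ω, ∏ i ∈ Finset.range N, ∫⁻ m, expNeg (u i (Z ω) m) ∂μ ∂P := by
  have hpμ : IsProbabilityMeasure μ := hlaw 0 ▸ Measure.isProbabilityMeasure_map (hH 0).aemeasurable
  have hum : ∀ i z, Measurable fun m => expNeg (u i z m) := fun i z =>
    measurable_expNeg.comp ((hu i).comp measurable_prodMk_left)
  have hF : Measurable (Function.uncurry fun (z : 𝓩) (m : ℕ → M) =>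
      ∏ i ∈ Finset.range N, expNeg (u i z (m i))) := by
    refine Finset.measurable_fun_prod _ fun i _ => measurable_expNeg.comp ?_
    exact (hu i).comp (measurable_fst.prodMk ((measurable_pi_apply i).comp measurable_snd))
  have hprod : Measurable fun z => ∏ i ∈ Finset.range N, ∫⁻ m, expNeg (u i z m) ∂μ :=
    Finset.measurable_fun_prod _ fun i _ =>
      (measurable_expNeg.comp (hu i)).lintegral_prod_right'
  simp_rw [expNeg_sum]
  rw [lintegral_comp_env_marks hZ hH hHZ
    (F := fun z m => ∏ i ∈ Finset.range N, expNeg (u i z (m i))) hF, ← lintegral_map hprod hZ]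
  refine lintegral_congr fun z => ?_
  rw [lintegral_prod_eq_prod_lintegral_of_indepFun _ (fun i ω => expNeg (u i z (H i ω)))
    (hind.comp (fun i m => expNeg (u i z m)) (hum · z)) fun i => (hum i z).comp (hH i)]
  refine Finset.prod_congr rfl fun i _ => ?_
  rw [← hlaw i, lintegral_map (hum i z) (hH i)]

/-- The Laplace functional of an independently marked Poisson point process. -/
theorem lintegral_expNeg_tsum_marks {X : ℕ → Ω → E} {Λ : Measure E} [SigmaFinite Λ]
    (hX : IsPoissonPointProcess X Λ P) (hZ : Measurable Z) (hH : ∀ i, Measurable (H i))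
    (hlaw : ∀ i, P.map (H i) = μ) (hind : iIndepFun H P) (hHZ : IndepFun (fun ω i => H i ω) Z P)
    (hu : ∀ i, Measurable (Function.uncurry (u i))) {φ : E → ℝ≥0∞} (hφ : Measurable φ)
    (hφ1 : ∀ x, φ x ≤ 1) (huφ : ∀ᵐ ω ∂P, ∀ i, ∫⁻ m, expNeg (u i (Z ω) m) ∂μ = φ (X i ω)) :
    ∫⁻ ω, expNeg (∑' i, u i (Z ω) (H i ω)) ∂P = expNeg (∫⁻ x, (1 - φ x) ∂Λ) := by
  -- The mark average is itself of the form `e^{-f}`, possibly with `f = ∞`. For every `N` the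
  -- marked partial sum and the unmarked one built from `f` have the same transform, so the unmarked
  -- functional applies in the limit.
  obtain ⟨f, hf, hfφ⟩ := exists_measurable_expNeg_eq hφ hφ1
  have hlim : ∀ v : ℕ → Ω → ℝ≥0∞, (∀ i, Measurable (v i)) →
      Tendsto (fun N => ∫⁻ ω, expNeg (∑ i ∈ Finset.range N, v i ω) ∂P) atTop
        (𝓝 (∫⁻ ω, expNeg (∑' i, v i ω) ∂P)) := by
    intro v hv
    refine tendsto_lintegral_of_dominated_convergence (fun _ => 1)
      (fun N => measurable_expNeg.comp (Finset.measurable_fun_sum _ fun i _ => hv i))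
      (fun N => .of_forall fun ω => expNeg_le_one _) (by simp) (.of_forall fun ω => ?_)
    exact (continuous_expNeg.tendsto _).comp ENNReal.summable.hasSum.tendsto_sum_nat
  have h1 := hlim (fun i ω => u i (Z ω) (H i ω)) fun i => (hu i).comp (hZ.prodMk (hH i))
  have h2 := hlim (fun i ω => f (X i ω)) fun i => hf.comp (hX.measurable i)
  rw [lintegral_expNeg_tsum hX hf] at h2
  simp_rw [hfφ] at h2
  refine tendsto_nhds_unique h1 (h2.congr fun N => ?_)
  rw [lintegral_prod_expNeg_marks hZ hH hlaw hind hHZ hu]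
  refine lintegral_congr_ae (huφ.mono fun ω hω => ?_)
  simp only [expNeg_sum, hfφ, hω]

lemma indepFun_zero_succ (hH : ∀ i, Measurable (H i)) (hind : iIndepFun H P) :
    IndepFun (H 0) (fun ω i => H (i + 1) ω) P := by
  have h := indep_iSup_of_disjoint (S := {0}) (T := {0}ᶜ) (fun i => (hH i).comap_le)
    hind.iIndep disjoint_compl_right
  rw [IndepFun_iff_Indep]
  refine indep_of_indep_of_le_left (indep_of_indep_of_le_right h ?_) ?_
  · rw [MeasurableSpace.pi, MeasurableSpace.comap_iSup]
    refine iSup_le fun i => ?_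
    rw [MeasurableSpace.comap_comp]
    exact le_iSup₂_of_le (i + 1) (by simp) le_rfl
  · exact le_iSup₂_of_le 0 (by simp) le_rfl

/-- A sum of independently marked terms has no atom as soon as its first term has none. -/
theorem ae_tsum_marks_ne (hZ : Measurable Z) (hH : ∀ i, Measurable (H i))
    (hlaw : P.map (H 0) = μ) (hind : iIndepFun H P) (hHZ : IndepFun (fun ω i => H i ω) Z P)
    (hu : ∀ i, Measurable (Function.uncurry (u i)))
    (hatom : ∀ᵐ ω ∂P, ∀ c : ℝ≥0∞, c ≠ ∞ → μ {m | u 0 (Z ω) m = c} = 0) {t : ℝ≥0∞} (ht : t ≠ ∞) :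
    ∀ᵐ ω ∂P, ∑' i, u i (Z ω) (H i ω) ≠ t := by
  have hpμ : IsProbabilityMeasure μ := hlaw ▸ Measure.isProbabilityMeasure_map (hH 0).aemeasurable
  have huz : ∀ i z, Measurable (u i z) := fun i z => (hu i).comp measurable_prodMk_left
  let F : 𝓩 → (ℕ → M) → ℝ≥0∞ := fun z m => Set.indicator {t} (fun _ => 1) (∑' i, u i z (m i))
  have hF : Measurable (Function.uncurry F) := by
    refine (measurable_const.indicator (measurableSet_singleton t)).comp (Measurable.tsum fun i => ?_)
    exact (hu i).comp (measurable_fst.prodMk ((measurable_pi_apply i).comp measurable_snd))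
  have hFZ : Measurable fun ω => F (Z ω) fun i => H i ω :=
    hF.comp (hZ.prodMk (measurable_pi_lambda _ hH))
  have hinner : Measurable fun z => ∫⁻ ω, F z (fun i => H i ω) ∂P := by
    refine Measurable.lintegral_prod_right' (f := fun p : 𝓩 × Ω => F p.1 fun i => H i p.2) ?_
    exact hF.comp (measurable_fst.prodMk (measurable_pi_lambda _ fun i => (hH i).comp measurable_snd))
  have hz : ∀ z, (∀ c : ℝ≥0∞, c ≠ ∞ → μ {m | u 0 z m = c} = 0) →
      ∫⁻ ω, F z (fun i => H i ω) ∂P = 0 := by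
    intro z hc
    let R : (ℕ → M) → ℝ≥0∞ := fun m => ∑' i, u (i + 1) z (m i)
    have hR : Measurable R := Measurable.tsum fun i => (huz _ z).comp (measurable_pi_apply i)
    have hm0 : Measurable fun ω i => H (i + 1) ω := measurable_pi_lambda _ fun i => hH _
    have hjoint := (indepFun_iff_map_prod_eq_prod_map_map hm0.aemeasurable
      (hH 0).aemeasurable).mp (indepFun_zero_succ hH hind).symm
    have hp : IsProbabilityMeasure (P.map fun ω i => H (i + 1) ω) :=
      Measure.isProbabilityMeasure_map hm0.aemeasurable
    have hsplit : ∀ ω, F z (fun i => H i ω) =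
        Set.indicator {t} (fun _ => 1) (u 0 z (H 0 ω) + R fun i => H (i + 1) ω) := by
      intro ω
      simp only [F, R]
      rw [tsum_eq_zero_add' ENNReal.summable]
    have hG : Measurable fun p : (ℕ → M) × M =>
        Set.indicator {t} (fun _ => (1 : ℝ≥0∞)) (u 0 z p.2 + R p.1) :=
      (measurable_const.indicator (measurableSet_singleton t)).comp
        (((huz 0 z).comp measurable_snd).add (hR.comp measurable_fst))
    simp_rw [hsplit]
    rw [← lintegral_map (f := fun p : (ℕ → M) × M =>
        Set.indicator {t} (fun _ => (1 : ℝ≥0∞)) (u 0 z p.2 + R p.1)) hG (hm0.prodMk (hH 0)),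
      hjoint, lintegral_prod _ hG.aemeasurable, hlaw]
    refine (lintegral_congr fun m => ?_).trans lintegral_zero
    -- With the environment and all later marks fixed, the sum equals `t` only if the first term
    -- takes the single finite value `t - R m`.
    have hsub : {x | u 0 z x + R m = t} ⊆ {x | u 0 z x = t - R m} := fun x hx => by
      have hx' : u 0 z x + R m = t := hx
      have : R m ≠ ∞ := fun h => ht (by rw [← hx', h, add_top])
      exact ENNReal.eq_sub_of_add_eq this hx'
    have hnull : μ {x | u 0 z x + R m = t} = 0 :=
      measure_mono_null hsub (hc _ (ENNReal.sub_ne_top ht))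
    have : ∀ x, Set.indicator {t} (fun _ => (1 : ℝ≥0∞)) (u 0 z x + R m) =
        Set.indicator {x | u 0 z x + R m = t} 1 x := fun x => rfl
    simp_rw [this]
    have hms : MeasurableSet {x | u 0 z x + R m = t} :=
      ((huz 0 z).add_const _) (measurableSet_singleton t)
    rw [lintegral_indicator_one hms, hnull]
  have hzero : ∫⁻ ω, F (Z ω) (fun i => H i ω) ∂P = 0 := by
    rw [lintegral_comp_env_marks hZ hH hHZ hF, lintegral_map hinner hZ]
    exact (lintegral_congr_ae (hatom.mono fun ω hω => hz _ hω)).trans lintegral_zero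
  filter_upwards [(lintegral_eq_zero_iff hFZ).mp hzero] with ω hω heq
  simp [F, heq] at hω

end Marks

/-! ### The SINR of one eavesdropper. -/

lemma measurable_l2norm {n : ℕ} : Measurable (l2norm : (Fin n → ℂ) → ℝ) := by
  unfold l2norm; fun_prop

lemma measurable_mrtBeamformer {n : ℕ} :
    Measurable (mrtBeamformer : (Fin n → ℂ) → Fin n → ℂ) := by
  refine measurable_pi_lambda _ fun j => ?_
  exact (Complex.continuous_conj.measurable.comp (measurable_pi_apply j)).div
    (Complex.measurable_ofReal.comp measurable_l2norm)

/-- The SINR of the `i`-th eavesdropper as a function of its fading vector `m` and of the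
environment `z`: the positions, the estimated channel, the artificial-noise matrix. -/
@[irreducible] noncomputable def envSINR {n : ℕ} (ζ Ps σ η : ℝ) (i : ℕ)
    (z : (ℕ → Plane) × (Fin n → ℂ) × (Fin n → Fin (n - 1) → ℂ)) (m : Fin n → ℂ) : ℝ :=
  eveSINR ζ Ps σ η (mrtBeamformer z.2.1) z.2.2 (z.1 i) m

lemma sinr_eq_envSINR {Ω : Type*} {n : ℕ} (ζ Ps σ η : ℝ) (g : Ω → Fin n → ℂ)
    (G : Ω → Matrix (Fin n) (Fin (n - 1)) ℂ) (X : ℕ → Ω → Plane) (h : ℕ → Ω → Fin n → ℂ)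
    (i : ℕ) (ω : Ω) :
    sinr ζ Ps σ η g G X h i ω =
      envSINR ζ Ps σ η i (fun i => X i ω, g ω, fun a b => G ω a b) (h i ω) := by
  rw [envSINR, sinr]

lemma envSINR_mk {n : ℕ} (ζ Ps σ η : ℝ) (i : ℕ) (x : ℕ → Plane) (g : Fin n → ℂ)
    (G : Matrix (Fin n) (Fin (n - 1)) ℂ) (m : Fin n → ℂ) :
    envSINR ζ Ps σ η i (x, g, fun a b => G a b) m =
      eveSINR ζ Ps σ η (mrtBeamformer g) G (x i) m := by
  rw [envSINR]

lemma measurable_envSINR {n : ℕ} (ζ Ps σ η : ℝ) (i : ℕ) :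
    Measurable fun p : ((ℕ → Plane) × (Fin n → ℂ) × (Fin n → Fin (n - 1) → ℂ)) × (Fin n → ℂ) =>
      envSINR ζ Ps σ η i p.1 p.2 := by
  have hw : Measurable fun p :
      ((ℕ → Plane) × (Fin n → ℂ) × (Fin n → Fin (n - 1) → ℂ)) × (Fin n → ℂ) =>
      mrtBeamformer p.1.2.1 ⬝ᵥ p.2 := by
    simp only [dotProduct]
    refine Finset.measurable_fun_sum _ fun i _ => Measurable.mul ?_ (by fun_prop)
    exact (measurable_pi_apply i).comp (measurable_mrtBeamformer.comp (by fun_prop))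
  have hG : Measurable fun p :
      ((ℕ → Plane) × (Fin n → ℂ) × (Fin n → Fin (n - 1) → ℂ)) × (Fin n → ℂ) =>
      l2norm (p.2 ᵥ* (p.1.2.2 : Matrix (Fin n) (Fin (n - 1)) ℂ)) := by
    refine measurable_l2norm.comp (measurable_pi_lambda _ fun j => ?_)
    simp only [Matrix.vecMul, dotProduct]
    fun_prop
  have hx : Measurable fun p :
      ((ℕ → Plane) × (Fin n → ℂ) × (Fin n → Fin (n - 1) → ℂ)) × (Fin n → ℂ) =>
      ‖p.1.1 i‖ ^ (-η) := by fun_prop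
  simp only [envSINR, eveSINR]
  exact ((hx.const_mul _).mul (hw.norm.pow_const 2)).div
    (((((hG.pow_const 2).const_mul _).mul hx).div_const _).add_const _)

section SINR

variable {k : ℕ} {η ζ Ps σ : ℝ}

lemma eveSINR_eq (hσ : 0 < σ) (w : Fin (k + 2) → ℂ) (G : Matrix (Fin (k + 2)) (Fin (k + 2 - 1)) ℂ)
    (x : Plane) (h : Fin (k + 2) → ℂ) :
    eveSINR ζ Ps σ η w G x h = ζ * (Ps / σ) * ‖x‖ ^ (-η) * ‖w ⬝ᵥ h‖ ^ 2 /
      ((1 - ζ) * (Ps / σ) / (((k + 2 : ℕ) : ℝ) - 1) * l2norm (h ᵥ* G) ^ 2 * ‖x‖ ^ (-η) + 1) := by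
  have hk : ((k + 2 : ℕ) : ℝ) - 1 ≠ 0 := by push_cast; intro h; linarith [Nat.cast_nonneg (α := ℝ) k]
  rw [eveSINR]
  set N := ((k + 2 : ℕ) : ℝ) - 1
  have hden : (1 - ζ) * (Ps / σ) / N * l2norm (h ᵥ* G) ^ 2 * ‖x‖ ^ (-η) + 1 =
      ((1 - ζ) * Ps * l2norm (h ᵥ* G) ^ 2 * ‖x‖ ^ (-η) / N + σ) / σ := by
    field_simp
  rw [hden, div_div_eq_mul_div]
  congr 1
  field_simp

lemma eveSINR_nonneg (hζ0 : 0 < ζ) (hζ1 : ζ < 1) (hPs : 0 < Ps) (hσ : 0 < σ)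
    (w : Fin (k + 2) → ℂ) (G : Matrix (Fin (k + 2)) (Fin (k + 2 - 1)) ℂ) (x : Plane)
    (h : Fin (k + 2) → ℂ) : 0 ≤ eveSINR ζ Ps σ η w G x h := by
  have h1 : 0 < 1 - ζ := sub_pos.mpr hζ1
  have hk : 0 < ((k + 2 : ℕ) : ℝ) - 1 := by push_cast; linarith [Nat.cast_nonneg (α := ℝ) k]
  have := Real.rpow_nonneg (norm_nonneg x) (-η)
  rw [eveSINR]
  positivity

lemma noise_coeff_pos (hζ1 : ζ < 1) (hPs : 0 < Ps) (hσ : 0 < σ) :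
    0 < (1 - ζ) * (Ps / σ) / (((k + 2 : ℕ) : ℝ) - 1) := by
  have h1 : 0 < 1 - ζ := sub_pos.mpr hζ1
  have hk : 0 < ((k + 2 : ℕ) : ℝ) - 1 := by push_cast; linarith [Nat.cast_nonneg (α := ℝ) k]
  positivity

/-- The beamformer and the noise matrix enter only through orthonormality, so the mark average
depends on the environment only through the position. -/
lemma lintegral_expNeg_eveSINR (hζ0 : 0 < ζ) (hζ1 : ζ < 1) (hPs : 0 < Ps) (hσ : 0 < σ) {s : ℝ}
    (hs : 0 < s) {w : Fin (k + 2) → ℂ} {G : Matrix (Fin (k + 2)) (Fin (k + 2 - 1)) ℂ}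
    (hwG : IsOrthonormalCompletion w G) (x : Plane) :
    ∫⁻ h, expNeg (ENNReal.ofReal (s * eveSINR ζ Ps σ η w G x h))
        ∂Measure.pi (fun _ : Fin (k + 2) => stdComplexGaussian) =
      markLaplace (ζ * (Ps / σ)) ((1 - ζ) * (Ps / σ) / (((k + 2 : ℕ) : ℝ) - 1)) η k s x := by
  simp_rw [fun h => expNeg_ofReal (mul_nonneg hs.le
    (eveSINR_nonneg (η := η) hζ0 hζ1 hPs hσ w G x h)), eveSINR_eq hσ]
  exact lintegral_projections_pi_stdComplexGaussian k hwG.1 hwG.2.1 hwG.2.2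
    (F := fun a b => ENNReal.ofReal (Real.exp (-(s * (ζ * (Ps / σ) * ‖x‖ ^ (-η) * a /
      ((1 - ζ) * (Ps / σ) / (((k + 2 : ℕ) : ℝ) - 1) * b * ‖x‖ ^ (-η) + 1))))))
    (by simp only [Function.uncurry_def]; fun_prop)

/-- For fixed noise power `b > 0` the SINR is a strictly increasing linear function of the
exponential variable `a`, so each value has one preimage. At the origin the convention `0 ^ (-η) =
0` for `η ≠ 0` would make the SINR constant. -/
lemma measure_eveSINR_eq (hζ0 : 0 < ζ) (hζ1 : ζ < 1) (hPs : 0 < Ps) (hσ : 0 < σ)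
    {w : Fin (k + 2) → ℂ} {G : Matrix (Fin (k + 2)) (Fin (k + 2 - 1)) ℂ}
    (hwG : IsOrthonormalCompletion w G) {x : Plane} (hx : x ≠ 0) (c : ℝ≥0∞) :
    Measure.pi (fun _ : Fin (k + 2) => stdComplexGaussian)
      {h | ENNReal.ofReal (eveSINR ζ Ps σ η w G x h) = c} = 0 := by
  set ϱ := (1 - ζ) * (Ps / σ) / (((k + 2 : ℕ) : ℝ) - 1) with hϱ
  have hϱ0 : 0 < ϱ := noise_coeff_pos hζ1 hPs hσ
  have hr : 0 < ‖x‖ ^ (-η) := Real.rpow_pos_of_pos (norm_pos_iff.mpr hx) _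
  let F : ℝ → ℝ → ℝ≥0∞ := fun a b => Set.indicator {c} (fun _ => 1)
    (ENNReal.ofReal (ζ * (Ps / σ) * ‖x‖ ^ (-η) * a / (ϱ * b * ‖x‖ ^ (-η) + 1)))
  have hF : Measurable (Function.uncurry F) :=
    (measurable_const.indicator (measurableSet_singleton c)).comp (by fun_prop)
  have hkey := lintegral_projections_pi_stdComplexGaussian k hwG.1 hwG.2.1 hwG.2.2 hF
  have hzero : ∫⁻ b, ∫⁻ a, F a b ∂gammaMeasure 1 1 ∂gammaMeasure (k + 1 : ℝ) 1 = 0 := by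
    refine (lintegral_congr_ae ?_).trans lintegral_zero
    filter_upwards [ae_pos_gammaMeasure (k + 1) 1] with b hb
    refine (lintegral_congr_ae ?_).trans lintegral_zero
    set d := ϱ * b * ‖x‖ ^ (-η) + 1 with hd
    have hd0 : 0 < d := by positivity
    have hne : ∀ᵐ a ∂gammaMeasure 1 1, a ≠ c.toReal * d / (ζ * (Ps / σ) * ‖x‖ ^ (-η)) := by
      have hac : gammaMeasure 1 1 ≪ volume := withDensity_absolutelyContinuous _ _
      have hv : ∀ᵐ a : ℝ, a ≠ c.toReal * d / (ζ * (Ps / σ) * ‖x‖ ^ (-η)) := by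
        rw [ae_iff]; simp
      exact hac.ae_le hv
    filter_upwards [ae_pos_gammaMeasure 1 1, hne] with a ha hne
    refine Set.indicator_of_notMem (fun hmem => hne ?_) _
    have hc : ENNReal.ofReal (ζ * (Ps / σ) * ‖x‖ ^ (-η) * a / d) = c := hmem
    rw [← hc, ENNReal.toReal_ofReal (by positivity)]
    field_simp
  have hmS : MeasurableSet {h : Fin (k + 2) → ℂ | ENNReal.ofReal (eveSINR ζ Ps σ η w G x h) = c} := by
    have hm : Measurable fun h : Fin (k + 2) → ℂ => ENNReal.ofReal (eveSINR ζ Ps σ η w G x h) := by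
      simp_rw [eveSINR_eq hσ]
      have h1 : Measurable fun h : Fin (k + 2) → ℂ => w ⬝ᵥ h := by
        simp only [dotProduct]; fun_prop
      have h2 : Measurable fun h : Fin (k + 2) → ℂ => l2norm (h ᵥ* G) := by
        refine measurable_l2norm.comp (measurable_pi_lambda _ fun j => ?_)
        simp only [Matrix.vecMul, dotProduct]
        fun_prop
      fun_prop
    exact hm (measurableSet_singleton c)
  rw [← lintegral_indicator_one hmS, ← hzero, ← hkey]
  refine lintegral_congr fun h => ?_
  simp only [F]
  rw [hϱ, ← eveSINR_eq hσ w G x h]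
  rfl

end SINR

/-! ### The colluding SINR: transform, finiteness, no positive atoms. -/

section Collusion

variable {Ω : Type*} [MeasurableSpace Ω] {P : Measure Ω} [IsProbabilityMeasure P]
  {k : ℕ} {η ζ Ps σ lam : ℝ}
  {X : ℕ → Ω → Plane} {g : Ω → Fin (k + 2) → ℂ}
  {G : Ω → Matrix (Fin (k + 2)) (Fin (k + 2 - 1)) ℂ} {h : ℕ → Ω → Fin (k + 2) → ℂ}

/-- The colluding SINR as an extended nonnegative number. -/
noncomputable def colludingSINRe (ζ Ps σ η : ℝ) (g : Ω → Fin (k + 2) → ℂ)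
    (G : Ω → Matrix (Fin (k + 2)) (Fin (k + 2 - 1)) ℂ) (X : ℕ → Ω → Plane)
    (h : ℕ → Ω → Fin (k + 2) → ℂ) (ω : Ω) : ℝ≥0∞ :=
  ∑' i, ENNReal.ofReal (sinr ζ Ps σ η g G X h i ω)

/-- True at every outcome, divergent ones included: there the real series and `∞.toReal` both take
the value 0. -/
lemma colludingSINR_eq_toReal (hζ0 : 0 < ζ) (hζ1 : ζ < 1) (hPs : 0 < Ps) (hσ : 0 < σ) (ω : Ω) :
    colludingSINR ζ Ps σ η g G X h ω = (colludingSINRe ζ Ps σ η g G X h ω).toReal := by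
  rw [colludingSINRe, ENNReal.tsum_toReal_eq fun _ => ENNReal.ofReal_ne_top]
  refine tsum_congr fun i => (ENNReal.toReal_ofReal ?_).symm
  exact eveSINR_nonneg hζ0 hζ1 hPs hσ _ _ _ _

lemma measurable_colludingSINRe (hXm : ∀ i, Measurable (X i)) (hg : Measurable g)
    (hG : ∀ a b, Measurable fun ω => G ω a b) (hh : ∀ i, Measurable (h i)) :
    Measurable (colludingSINRe ζ Ps σ η g G X h) := by
  have hG' : Measurable fun ω => (fun a b => G ω a b : Fin (k + 2) → Fin (k + 2 - 1) → ℂ) :=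
    measurable_pi_lambda _ fun a => measurable_pi_lambda _ fun b => hG a b
  refine Measurable.tsum fun i => ENNReal.measurable_ofReal.comp ?_
  rw [funext (sinr_eq_envSINR ζ Ps σ η g G X h i)]
  exact (measurable_envSINR ζ Ps σ η i).comp
    (((measurable_pi_lambda _ hXm).prodMk (hg.prodMk hG')).prodMk (hh i))

lemma measurable_uncurry_ofReal_envSINR (s : ℝ) (i : ℕ) :
    Measurable (Function.uncurry fun
      (z : (ℕ → Plane) × (Fin (k + 2) → ℂ) × (Fin (k + 2) → Fin (k + 2 - 1) → ℂ))
      (m : Fin (k + 2) → ℂ) => ENNReal.ofReal (s * envSINR ζ Ps σ η i z m)) :=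
  ENNReal.measurable_ofReal.comp ((measurable_envSINR ζ Ps σ η i).const_mul s)

lemma lintegral_expNeg_colludingSINRe (hζ0 : 0 < ζ) (hζ1 : ζ < 1) (hPs : 0 < Ps)
    (hσ : 0 < σ)
    (hX : IsPoissonPointProcess X (ENNReal.ofReal lam • (volume : Measure Plane)) P)
    (hg : Measurable g) (hG : ∀ a b, Measurable (fun ω => G ω a b))
    (hwG : ∀ᵐ ω ∂P, IsOrthonormalCompletion (mrtBeamformer (g ω)) (G ω))
    (hh : ∀ i, Measurable (h i))
    (hlaw : ∀ i, HasLaw (h i) (Measure.pi (fun _ : Fin (k + 2) => stdComplexGaussian)) P)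
    (hindep : iIndepFun h P)
    (hindep_env : IndepFun (fun ω (i : ℕ) => h i ω)
      (fun ω => ((fun i : ℕ => X i ω), g ω,
        (fun a b => G ω a b : Fin (k + 2) → Fin (k + 2 - 1) → ℂ))) P)
    {s : ℝ} (hs : 0 < s) :
    ∫⁻ ω, expNeg (ENNReal.ofReal s * colludingSINRe ζ Ps σ η g G X h ω) ∂P =
      expNeg (ENNReal.ofReal lam * ∫⁻ x : Plane, (1 - markLaplace (ζ * (Ps / σ))
        ((1 - ζ) * (Ps / σ) / (((k + 2 : ℕ) : ℝ) - 1)) η k s x)) := by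
  have ha₁ : 0 < ζ * (Ps / σ) := by positivity
  have hϱ := noise_coeff_pos (k := k) hζ1 hPs hσ
  have hG' : Measurable fun ω => (fun a b => G ω a b : Fin (k + 2) → Fin (k + 2 - 1) → ℂ) :=
    measurable_pi_lambda _ fun a => measurable_pi_lambda _ fun b => hG a b
  have hfin : SigmaFinite (ENNReal.ofReal lam • (volume : Measure Plane)) :=
    inferInstanceAs (SigmaFinite (lam.toNNReal • (volume : Measure Plane)))
  have key := lintegral_expNeg_tsum_marks hX
    ((measurable_pi_lambda _ hX.measurable).prodMk (hg.prodMk hG')) hh (fun i => (hlaw i).map_eq)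
    hindep hindep_env
    (u := fun i z m => ENNReal.ofReal (s * envSINR ζ Ps σ η i z m))
    (measurable_uncurry_ofReal_envSINR s)
    (measurable_markLaplace (ζ * (Ps / σ)) ((1 - ζ) * (Ps / σ) / (((k + 2 : ℕ) : ℝ) - 1)) η k s)
    (markLaplace_le_one k ha₁ hϱ hs)
    (hwG.mono fun ω hω i => by
      simp only [envSINR_mk]
      exact lintegral_expNeg_eveSINR hζ0 hζ1 hPs hσ hs hω (X i ω))
  rw [lintegral_smul_measure, smul_eq_mul] at key
  rw [← key]
  refine lintegral_congr fun ω => ?_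
  rw [colludingSINRe, ← ENNReal.tsum_mul_left]
  simp_rw [← ENNReal.ofReal_mul hs.le, sinr_eq_envSINR]

/-- Since `e^{-∞} = 0`, the probability of finiteness is at least the transform at any `s > 0`,
hence at least `exp(-λ C (s a₁)^{2/η})`. Letting `s → 0` through `1/(m+1)` gives 1. -/
lemma ae_colludingSINRe_ne_top (hη : 2 < η) (hζ0 : 0 < ζ) (hζ1 : ζ < 1) (hPs : 0 < Ps)
    (hσ : 0 < σ)
    (hX : IsPoissonPointProcess X (ENNReal.ofReal lam • (volume : Measure Plane)) P)
    (hg : Measurable g) (hG : ∀ a b, Measurable (fun ω => G ω a b))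
    (hwG : ∀ᵐ ω ∂P, IsOrthonormalCompletion (mrtBeamformer (g ω)) (G ω))
    (hh : ∀ i, Measurable (h i))
    (hlaw : ∀ i, HasLaw (h i) (Measure.pi (fun _ : Fin (k + 2) => stdComplexGaussian)) P)
    (hindep : iIndepFun h P)
    (hindep_env : IndepFun (fun ω (i : ℕ) => h i ω)
      (fun ω => ((fun i : ℕ => X i ω), g ω,
        (fun a b => G ω a b : Fin (k + 2) → Fin (k + 2 - 1) → ℂ))) P) :
    ∀ᵐ ω ∂P, colludingSINRe ζ Ps σ η g G X h ω ≠ ∞ := by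
  have ha₁ : 0 < ζ * (Ps / σ) := by positivity
  have hϱ := noise_coeff_pos (k := k) hζ1 hPs hσ
  have hη0 : 0 < η := by linarith
  set S := colludingSINRe ζ Ps σ η g G X h with hS
  set C : ℝ := 2 * Real.pi * (beta (2 / η) (1 - 2 / η) / η) with hC
  have hSm : Measurable S := measurable_colludingSINRe hX.measurable hg hG hh
  have hms : MeasurableSet {ω | S ω ≠ ∞} := (hSm (measurableSet_singleton ∞)).compl
  have hbound : ∀ s : ℝ, 0 < s →
      expNeg (ENNReal.ofReal lam * ENNReal.ofReal (C * (s * (ζ * (Ps / σ))) ^ (2 / η))) ≤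
        P {ω | S ω ≠ ∞} := by
    intro s hs
    have h1 : ∫⁻ ω, expNeg (ENNReal.ofReal s * S ω) ∂P ≤ P {ω | S ω ≠ ∞} := by
      rw [← lintegral_indicator_one hms]
      refine lintegral_mono fun ω => ?_
      by_cases hω : S ω = ∞
      · rw [hω, ENNReal.mul_top (by simpa using hs), expNeg_top]
        exact zero_le
      · rw [Set.indicator_of_mem (show ω ∈ {ω | S ω ≠ ∞} from hω)]
        exact expNeg_le_one _
    refine le_trans ?_ h1
    rw [lintegral_expNeg_colludingSINRe hζ0 hζ1 hPs hσ hX hg hG hwG hh hlaw hindep hindep_env hs]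
    exact expNeg_antitone (mul_le_mul_right (lintegral_one_sub_markLaplace_le k ha₁ hϱ hη hs) _)
  have hlim : Tendsto (fun m : ℕ => expNeg (ENNReal.ofReal lam *
      ENNReal.ofReal (C * (1 / ((m : ℝ) + 1) * (ζ * (Ps / σ))) ^ (2 / η)))) atTop (𝓝 1) := by
    have h1 : Tendsto (fun m : ℕ => 1 / ((m : ℝ) + 1) * (ζ * (Ps / σ))) atTop
        (𝓝 (0 * (ζ * (Ps / σ)))) := tendsto_one_div_add_atTop_nhds_zero_nat.mul_const _
    rw [zero_mul] at h1
    have h2 := ((h1.rpow_const (Or.inr (by positivity : 0 ≤ 2 / η))).const_mul C)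
    rw [Real.zero_rpow (by positivity), mul_zero] at h2
    have h3 := ENNReal.Tendsto.const_mul (a := ENNReal.ofReal lam) (ENNReal.tendsto_ofReal h2)
      (Or.inr ENNReal.ofReal_ne_top)
    rw [ENNReal.ofReal_zero, mul_zero] at h3
    rw [← expNeg_zero]
    exact (continuous_expNeg.tendsto 0).comp h3
  have hone : 1 ≤ P {ω | S ω ≠ ∞} :=
    le_of_tendsto hlim (.of_forall fun m => hbound _ (by positivity))
  exact (mem_ae_iff_prob_eq_one hms).mpr (le_antisymm prob_le_one hone)

/-- The extended sum has no finite atom, because the first eavesdropper is almost surely off the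
origin. Positivity of `t` excludes divergent outcomes, where the real-valued sum is 0. -/
lemma ae_colludingSINR_ne (hζ0 : 0 < ζ) (hζ1 : ζ < 1) (hPs : 0 < Ps) (hσ : 0 < σ)
    (hX : IsPoissonPointProcess X (ENNReal.ofReal lam • (volume : Measure Plane)) P)
    (hg : Measurable g) (hG : ∀ a b, Measurable (fun ω => G ω a b))
    (hwG : ∀ᵐ ω ∂P, IsOrthonormalCompletion (mrtBeamformer (g ω)) (G ω))
    (hh : ∀ i, Measurable (h i))
    (hlaw : ∀ i, HasLaw (h i) (Measure.pi (fun _ : Fin (k + 2) => stdComplexGaussian)) P)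
    (hindep : iIndepFun h P)
    (hindep_env : IndepFun (fun ω (i : ℕ) => h i ω)
      (fun ω => ((fun i : ℕ => X i ω), g ω,
        (fun a b => G ω a b : Fin (k + 2) → Fin (k + 2 - 1) → ℂ))) P)
    {t : ℝ} (ht : 0 < t) :
    ∀ᵐ ω ∂P, colludingSINR ζ Ps σ η g G X h ω ≠ t := by
  have hG' : Measurable fun ω => (fun a b => G ω a b : Fin (k + 2) → Fin (k + 2 - 1) → ℂ) :=
    measurable_pi_lambda _ fun a => measurable_pi_lambda _ fun b => hG a b
  have hX0 := ae_forall_notMem_of_measure_zero hX (measurableSet_singleton (0 : Plane)) (by simp)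
  have key := ae_tsum_marks_ne
    ((measurable_pi_lambda _ hX.measurable).prodMk (hg.prodMk hG')) hh (hlaw 0).map_eq
    hindep hindep_env
    (u := fun i z m => ENNReal.ofReal (1 * envSINR ζ Ps σ η i z m))
    (measurable_uncurry_ofReal_envSINR 1)
    (by
      filter_upwards [hwG, hX0] with ω hω hω0 c _
      simp only [one_mul, envSINR_mk]
      exact measure_eveSINR_eq hζ0 hζ1 hPs hσ hω (hω0 0) c) (ENNReal.ofReal_ne_top (r := t))
  filter_upwards [key] with ω hω heq
  refine hω ?_
  simp only [one_mul, ← sinr_eq_envSINR]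
  rw [← colludingSINRe]
  rw [colludingSINR_eq_toReal hζ0 hζ1 hPs hσ] at heq
  rw [← heq, ENNReal.ofReal_toReal]
  intro htop
  rw [htop, ENNReal.toReal_top] at heq
  exact ht.ne heq

end Collusion

/-! ### Assembly of the result. -/

theorem lemma2 {Ω : Type*} [MeasurableSpace Ω] (P : Measure Ω) [IsProbabilityMeasure P]
    -- number of antennas, path loss exponent, power ratio, power, noise power, density
    (n : ℕ) (hn : 2 ≤ n) (η ζ Ps σ lam : ℝ) (hη : 2 < η) (hζ0 : 0 < ζ) (hζ1 : ζ < 1)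
    (hPs : 0 < Ps) (hσ : 0 < σ) (hlam : 0 < lam)
    -- positions of the eavesdroppers: homogeneous Poisson point process of density `lam`
    (X : ℕ → Ω → Plane)
    (hX : IsPoissonPointProcess X (ENNReal.ofReal lam • (volume : Measure Plane)) P)
    -- estimated legitimate channel, and artificial-noise matrix completing the beamformer
    (g : Ω → Fin n → ℂ) (hg : Measurable g)
    (G : Ω → Matrix (Fin n) (Fin (n - 1)) ℂ) (hG : ∀ a b, Measurable (fun ω => G ω a b))
    (hg0 : ∀ᵐ ω ∂P, g ω ≠ 0)
    (hwG : ∀ᵐ ω ∂P, IsOrthonormalCompletion (mrtBeamformer (g ω)) (G ω))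
    -- fading vectors of the eavesdroppers: i.i.d. with i.i.d. `CN(0,1)` entries, and independent
    -- of the positions and of the legitimate link
    (h : ℕ → Ω → Fin n → ℂ) (hh : ∀ i, Measurable (h i))
    (hlaw : ∀ i, HasLaw (h i) (Measure.pi (fun _ : Fin n => stdComplexGaussian)) P)
    (hindep : iIndepFun h P)
    (hindep_env : IndepFun (fun ω (i : ℕ) => h i ω)
      (fun ω => ((fun i : ℕ => X i ω), g ω, (fun a b => G ω a b : Fin n → Fin (n - 1) → ℂ))) P) :
    -- the colluding SINR is almost surely a convergent sum
    (∀ᵐ ω ∂P, Summable (fun i => sinr ζ Ps σ η g G X h i ω)) ∧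
    -- closed form of its Laplace transform
    (∀ s : ℝ, 0 < s →
      laplace P (colludingSINR ζ Ps σ η g G X h) s =
        (let a₁ : ℝ := ζ * (Ps / σ)
         let ϱ : ℝ := (1 - ζ) * (Ps / σ) / ((n : ℝ) - 1)
         let ς : ℝ := ζ * ((n : ℝ) - 1) / (1 - ζ)
         let B : ℝ := beta (2 / η) (1 - 2 / η) / η * ϱ ^ ((1 - (n : ℝ) + 2 / η) / 2)
         Real.exp (-2 * Real.pi * lam * B * Real.exp (ς * s / 2)
            * (a₁ * s) ^ (((n : ℝ) - 1 + 2 / η) / 2)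
            * whittakerW ((1 - (n : ℝ) + 2 / η) / 2) ((2 - (n : ℝ) - 2 / η) / 2) (ς * s)))) ∧
    -- approximation of the complementary cumulative distribution function
    (∀ t : ℝ, 0 < t →
      Tendsto (fun K : ℕ => gammaSmoothedCcdf P (colludingSINR ζ Ps σ η g G X h) K t) atTop
        (𝓝 (ccdf P (colludingSINR ζ Ps σ η g G X h) t)) ∧
      ∀ K : ℕ, 1 ≤ K →
        laplaceCcdfApprox P (colludingSINR ζ Ps σ η g G X h) K t
            ≤ gammaSmoothedCcdf P (colludingSINR ζ Ps σ η g G X h) K t ∧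
        laplaceCcdfApprox P (colludingSINR ζ Ps σ η g G X h) K t
            = ∫ ω, (1 - Real.exp (-alzer K * (colludingSINR ζ Ps σ η g G X h ω / t))) ^ K ∂P) := by
  obtain ⟨k, rfl⟩ := Nat.exists_eq_add_of_le' hn
  have ha₁ : 0 < ζ * (Ps / σ) := by positivity
  have hϱ := noise_coeff_pos (k := k) hζ1 hPs hσ
  set S := colludingSINRe ζ Ps σ η g G X h with hS
  have hSm : Measurable S := measurable_colludingSINRe hX.measurable hg hG hh
  have hSfin : ∀ᵐ ω ∂P, S ω ≠ ∞ :=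
    ae_colludingSINRe_ne_top hη hζ0 hζ1 hPs hσ hX hg hG hwG hh hlaw hindep hindep_env
  have hY : colludingSINR ζ Ps σ η g G X h = fun ω => (S ω).toReal :=
    funext (colludingSINR_eq_toReal hζ0 hζ1 hPs hσ)
  have hYm : Measurable (colludingSINR ζ Ps σ η g G X h) := hY ▸ hSm.ennreal_toReal
  have hY0 : ∀ ω, 0 ≤ colludingSINR ζ Ps σ η g G X h ω := fun ω => by
    rw [hY]; exact ENNReal.toReal_nonneg
  refine ⟨?_, fun s hs => ?_, fun t ht => ⟨?_, fun K hK => ⟨?_, ?_⟩⟩⟩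
  · filter_upwards [hSfin] with ω hω
    refine (ENNReal.summable_toReal hω).congr fun i => ENNReal.toReal_ofReal ?_
    exact eveSINR_nonneg hζ0 hζ1 hPs hσ _ _ _ _
  -- The Whittaker argument is `ς s` with `ς = a₁/ϱ`: the transmit and noise powers cancel.
  · have hς : ζ * (((k + 2 : ℕ) : ℝ) - 1) / (1 - ζ) =
        ζ * (Ps / σ) / ((1 - ζ) * (Ps / σ) / (((k + 2 : ℕ) : ℝ) - 1)) := by
      have hk : 0 < ((k + 2 : ℕ) : ℝ) - 1 := by
        push_cast; linarith [Nat.cast_nonneg (α := ℝ) k]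
      have h1 : 0 < 1 - ζ := sub_pos.mpr hζ1
      field_simp
    obtain ⟨hC0, hC⟩ := lintegral_one_sub_markLaplace_eq_whittakerW k ha₁ hϱ hη hs rfl
    have hL := lintegral_expNeg_colludingSINRe (η := η) hζ0 hζ1 hPs hσ hX hg hG hwG hh hlaw hindep
      hindep_env hs
    rw [hC, ← ENNReal.ofReal_mul hlam.le, expNeg_ofReal (mul_nonneg hlam.le hC0)] at hL
    have hlap : laplace P (colludingSINR ζ Ps σ η g G X h) s =
        (∫⁻ ω, expNeg (ENNReal.ofReal s * S ω) ∂P).toReal := by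
      rw [laplace, integral_eq_lintegral_of_nonneg_ae (.of_forall fun ω => (Real.exp_pos _).le)
        (hYm.const_mul _).exp.aestronglyMeasurable]
      congr 1
      refine lintegral_congr_ae (hSfin.mono fun ω hω => ?_)
      simp only
      rw [expNeg_eq_ofReal (ENNReal.mul_ne_top ENNReal.ofReal_ne_top hω), ENNReal.toReal_mul,
        ENNReal.toReal_ofReal hs.le, hY, neg_mul]
    dsimp only
    rw [hlap, hL, ENNReal.toReal_ofReal (Real.exp_pos _).le, hς]
    congr 1
    ring
  · exact tendsto_gammaSmoothedCcdf hYm ht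
      (ae_colludingSINR_ne hζ0 hζ1 hPs hσ hX hg hG hwG hh hlaw hindep hindep_env ht)
  · exact laplaceCcdfApprox_le_gammaSmoothedCcdf hYm hY0 ht hK
  · exact laplaceCcdfApprox_eq_integral hYm hY0 ht K
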